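/- Let $\Omega$ be a probability distribution on $\mathbb{R}$ with finite sixth moment, write $m_k = E_{x\sim\Omega}[x^k]$ for its $k$-th moment, and assume that $m_1 = m_3 = 0$ and $m_2 = 1$. For $n \ge 0$ let $f_6(n) = E[\det(M)^6]$, where $M$ is a random $n \times n$ matrix whose entries are drawn independently from $\Omega$ (so $f_6(0) = 1$). Then these expectations exist, and, as an identity of formal power series in $t$ with real coefficients, the generating function $F_6(t) = \sum_{n=0}^{\infty} \frac{t^n}{(n!)^2} f_6(n)$ is $$F_6(t) = \frac{e^{t(m_6 - 15 m_4 + 30)}}{48\,(1+3t-m_4 t)^{15}} \sum_{i=0}^{\infty} \frac{(1+i)(2+i)\,(4+i)!\; t^i}{(1+3t-m_4 t)^{3i}},$$ where the infinite sum of formal power series converges coefficientwise. -/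

import Mathlib

open MeasureTheory
open scoped PowerSeries.WithPiTopology

noncomputable section

/-- The `k`-th moment `m_k = E_{x ∼ Ω}[x ^ k]` of a distribution `Ω` on the real line. -/
def entryMoment (Ω : Measure ℝ) (k : ℕ) : ℝ :=
  ∫ x, x ^ k ∂Ω

/-- The product (entrywise) Borel σ-algebra on real matrices. -/
instance matrixMeasurableSpace (n : ℕ) : MeasurableSpace (Matrix (Fin n) (Fin n) ℝ) :=
  inferInstanceAs (MeasurableSpace (Fin n → Fin n → ℝ))

/-- The distribution of `n × n` real matrices whose entries are drawn independently from `Ω`: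
the product measure over all positions `(i, j)`, transported to matrices. -/
def matrixDist (Ω : Measure ℝ) (n : ℕ) : Measure (Matrix (Fin n) (Fin n) ℝ) :=
  (Measure.pi fun _ : Fin n × Fin n => Ω).map fun x => Matrix.of fun i j => x (i, j)

/-- `f_k(n) = E[det(M) ^ k]` for a random `n × n` matrix `M` with independent entries
drawn from `Ω`. -/
def detMoment (Ω : Measure ℝ) (k n : ℕ) : ℝ :=
  ∫ M, M.det ^ k ∂(matrixDist Ω n)

/-- The formal generating function `F_k(t) = ∑ₙ tⁿ f_k(n) / (n!)²`. -/
def detGenFun (Ω : Measure ℝ) (k : ℕ) : PowerSeries ℝ :=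
  PowerSeries.mk fun n => detMoment Ω k n / (n.factorial : ℝ) ^ 2

/-- The formal power series `e ^ (c t) = ∑ₙ cⁿ tⁿ / n!`. -/
def formalExp (c : ℝ) : PowerSeries ℝ :=
  PowerSeries.rescale c (PowerSeries.exp ℝ)

/-- The polynomial `1 + 3 t - m₄ t`, as a formal power series. -/
def denomSeries (Ω : Measure ℝ) : PowerSeries ℝ :=
  1 + PowerSeries.C 3 * PowerSeries.X - PowerSeries.C (entryMoment Ω 4) * PowerSeries.X

/-- The `i`-th summand `(1 + i) (2 + i) (4 + i)! tⁱ / (1 + 3 t - m₄ t) ^ (3 i)`. The inverse is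
that of formal power series; the series inverted has constant coefficient `1`. -/
def genFunTerm (Ω : Measure ℝ) (i : ℕ) : PowerSeries ℝ :=
  PowerSeries.C ((1 + (i : ℝ)) * (2 + (i : ℝ)) * ((4 + i).factorial : ℝ)) * PowerSeries.X ^ i *
    (denomSeries Ω ^ (3 * i))⁻¹

end

/-! Expand `det ^ 6` over six permutations: the exponents in each column add up to six, so a fifth
moment always comes with a factor `m_1 = 0`. Hence the expectation depends only on the moments up to
order six other than the fifth, and `Ω` may be replaced by a signed law on seven points
(`detMoment_six_eq_detSixth`). This law is moved along a line on which its cumulants are `(s κ₄, s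
κ₆)`, with `κ₄ = m_4 - 3`, `κ₆ = m_6 - 15 m_4 + 30` and `s` going from `0` to `1`.

At `s = 0` the moments up to order six are Gaussian, and rotating the rows gives a closed form
(`HasCumulants.detSixth_of_gaussian`). The `s`-derivative at size `n + 1` is a combination of `E[det
^ 6]` and the mixed moment `E[det ^ 4 * ∑ adjugate ^ 2]` at size `n`
(`HasCumulants.hasDerivAt_detSixth`), and the mixed moment obeys a recursion in `n`
(`HasCumulants.detFourthCofactor_succ`). Let `F`, `G` be the generating functions of the two
moments, divided by `(n!)²`. With `k₄ = s κ₄` and `k₆ = s κ₆` these facts read `∂ₛF = t ((κ₆ + 15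
κ₄) F + 15 κ₄ G)` and `G = t F' / 5 - k₆ t F / 5 - 2 k₄ t (F + G)`.

Each `t ^ r e ^ (k₆ t) / (1 - k₄ t) ^ (15 + 3 r)`, with an explicit companion, solves both equations
and equals `t ^ r` at `s = 0`. Their combination with the Gaussian coefficients is therefore `F`, by
induction on `n` (`detSixth_eq_coeff`). -/

/-! ### Finitely supported signed laws -/

/-- The sum of `g` over families `u : Fin n → ι`, weighted by the product of the weights `w`. -/
def weightedSum {ι : Type*} [Fintype ι] (w : ι → ℝ) {n : ℕ} (g : (Fin n → ι) → ℝ) : ℝ :=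
  ∑ u, (∏ j, w (u j)) * g u

/-- The product weight on families `Fin n → ι`. -/
def prodWeight {ι : Type*} (w : ι → ℝ) (n : ℕ) (u : Fin n → ι) : ℝ := ∏ j, w (u j)

/-- The weights `w` on the points `v` have the first six moments of a symmetric law of variance `1`
with fourth and sixth cumulants `κ₄` and `κ₆`. -/
structure HasCumulants {ι : Type*} [Fintype ι] (w v : ι → ℝ) (κ₄ κ₆ : ℝ) : Prop where
  zero : ∑ i, w i = 1
  one : ∑ i, w i * v i = 0
  two : ∑ i, w i * v i ^ 2 = 1
  three : ∑ i, w i * v i ^ 3 = 0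
  four : ∑ i, w i * v i ^ 4 = 3 + κ₄
  five : ∑ i, w i * v i ^ 5 = 0
  six : ∑ i, w i * v i ^ 6 = 15 + 15 * κ₄ + κ₆

section WeightedSum

variable {ι : Type*} [Fintype ι] (w v : ι → ℝ) {n : ℕ}

lemma weightedSum_add (g h : (Fin n → ι) → ℝ) :
    weightedSum w (fun u => g u + h u) = weightedSum w g + weightedSum w h := by
  simp [weightedSum, mul_add, Finset.sum_add_distrib]

lemma weightedSum_mul_left (c : ℝ) (g : (Fin n → ι) → ℝ) :
    weightedSum w (fun u => c * g u) = c * weightedSum w g := by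
  simp only [weightedSum, Finset.mul_sum]
  exact Finset.sum_congr rfl fun _ _ => by ring

lemma weightedSum_sum {α : Type*} (s : Finset α) (g : α → (Fin n → ι) → ℝ) :
    weightedSum w (fun u => ∑ i ∈ s, g i u) = ∑ i ∈ s, weightedSum w (g i) := by
  simp only [weightedSum, Finset.mul_sum]
  rw [Finset.sum_comm]

lemma weightedSum_succ (g : (Fin (n + 1) → ι) → ℝ) :
    weightedSum w g = ∑ x, w x * weightedSum w (fun u : Fin n → ι => g (Fin.cons x u)) := by
  rw [weightedSum, ← (Fin.consEquiv fun _ : Fin (n + 1) => ι).sum_comp, Fintype.sum_prod_type]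
  refine Finset.sum_congr rfl fun x _ => ?_
  simp [weightedSum, Finset.mul_sum, Fin.consEquiv, Fin.prod_univ_succ, mul_assoc]

lemma weightedSum_succ' (g : (Fin (n + 1) → ι) → ℝ) :
    weightedSum w g = weightedSum w fun u : Fin n → ι => ∑ x, w x * g (Fin.cons x u) := by
  simp only [weightedSum_succ, weightedSum_sum, weightedSum_mul_left]

lemma weightedSum_zero (g : (Fin 0 → ι) → ℝ) : weightedSum w g = g Fin.elim0 := by
  rw [weightedSum, Fintype.sum_unique]
  simp only [Finset.univ_eq_empty, Finset.prod_empty, one_mul]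
  congr 1

lemma sum_prodWeight_mul (g : (Fin n → ι) → ℝ) :
    ∑ u, prodWeight w n u * g u = weightedSum w g := rfl

lemma sum_prodWeight (hw : ∑ i, w i = 1) (n : ℕ) : ∑ u, prodWeight w n u = 1 := by
  have := Finset.prod_univ_sum (fun _ : Fin n => (Finset.univ : Finset ι)) (fun _ i => w i)
  simp only [hw, Finset.prod_const_one, Fintype.piFinset_univ] at this
  exact this.symm

lemma weightedSum_const (hw : ∑ i, w i = 1) (c : ℝ) :
    weightedSum w (fun _ : Fin n → ι => c) = c := by
  have := sum_prodWeight w hw n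
  rw [weightedSum, ← Finset.sum_mul]
  simp only [prodWeight] at this
  rw [this, one_mul]

lemma weightedSum_reindex (σ : Equiv.Perm (Fin n)) (g : (Fin n → ι) → ℝ) :
    weightedSum w (fun u => g (u ∘ σ)) = weightedSum w g := by
  symm
  rw [weightedSum, weightedSum, ← (Equiv.arrowCongr σ.symm (Equiv.refl ι)).sum_comp]
  refine Finset.sum_congr rfl fun u _ => ?_
  have hu : Equiv.arrowCongr σ.symm (Equiv.refl ι) u = u ∘ σ := by
    ext; simp [Equiv.arrowCongr]
  rw [hu]
  congr 1
  exact Equiv.prod_comp σ fun j => w (u j)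

/-- Splitting off the first column. -/
lemma weightedSum_prodWeight_succ {m : ℕ} (g : (Fin m → Fin (n + 1) → ι) → ℝ) :
    weightedSum (prodWeight w (n + 1)) g =
      weightedSum (prodWeight w n) fun D : Fin m → Fin n → ι =>
        weightedSum w fun c : Fin m → ι => g fun i => Fin.cons (c i) (D i) := by
  let e : (Fin m → ι) × (Fin m → Fin n → ι) ≃ (Fin m → Fin (n + 1) → ι) :=
    (Equiv.arrowProdEquivProdArrow (Fin m) (fun _ => ι) (fun _ => Fin n → ι)).symm.trans
      (Equiv.piCongrRight fun _ => Fin.consEquiv fun _ : Fin (n + 1) => ι)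
  rw [weightedSum, ← e.sum_comp, Fintype.sum_prod_type, Finset.sum_comm]
  refine Finset.sum_congr rfl fun D _ => ?_
  simp only [weightedSum, Finset.mul_sum]
  refine Finset.sum_congr rfl fun c _ => ?_
  have h' : e (c, D) = fun i => Fin.cons (c i) (D i) := rfl
  simp only [h', prodWeight, Fin.prod_univ_succ, Fin.cons_zero, Fin.cons_succ,
    Finset.prod_mul_distrib]
  ring

variable {w v} {κ₄ κ₆ : ℝ} (h : HasCumulants w v κ₄ κ₆)
include h


lemma HasCumulants.sum_affine_sq (c y : ℝ) :
    ∑ x, w x * (c * v x + y) ^ 2 = c ^ 2 + y ^ 2 := by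
  have e : ∀ x, w x * (c * v x + y) ^ 2 =
      y ^ 2 * w x + 2 * c * y * (w x * v x) + c ^ 2 * (w x * v x ^ 2) := fun x => by ring
  simp only [e, Finset.sum_add_distrib, ← Finset.mul_sum, h.zero, h.one, h.two]
  ring

lemma HasCumulants.sum_affine_pow_four (c y : ℝ) :
    ∑ x, w x * (c * v x + y) ^ 4 = c ^ 4 * (3 + κ₄) + 6 * c ^ 2 * y ^ 2 + y ^ 4 := by
  have e : ∀ x, w x * (c * v x + y) ^ 4 =
      y ^ 4 * w x + 4 * c * y ^ 3 * (w x * v x) + 6 * c ^ 2 * y ^ 2 * (w x * v x ^ 2) +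
        4 * c ^ 3 * y * (w x * v x ^ 3) + c ^ 4 * (w x * v x ^ 4) := fun x => by ring
  simp only [e, Finset.sum_add_distrib, ← Finset.mul_sum, h.zero, h.one, h.two, h.three, h.four]
  ring

lemma HasCumulants.sum_affine_pow_six (c y : ℝ) :
    ∑ x, w x * (c * v x + y) ^ 6 = c ^ 6 * (15 + 15 * κ₄ + κ₆) +
      15 * c ^ 4 * y ^ 2 * (3 + κ₄) + 15 * c ^ 2 * y ^ 4 + y ^ 6 := by
  have e : ∀ x, w x * (c * v x + y) ^ 6 =
      y ^ 6 * w x + 6 * c * y ^ 5 * (w x * v x) + 15 * c ^ 2 * y ^ 4 * (w x * v x ^ 2) +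
        20 * c ^ 3 * y ^ 3 * (w x * v x ^ 3) + 15 * c ^ 4 * y ^ 2 * (w x * v x ^ 4) +
        6 * c ^ 5 * y * (w x * v x ^ 5) + c ^ 6 * (w x * v x ^ 6) := fun x => by ring
  simp only [e, Finset.sum_add_distrib, ← Finset.mul_sum, h.zero, h.one, h.two, h.three, h.four,
    h.five, h.six]
  ring

lemma HasCumulants.weightedSum_sq (c : Fin n → ℝ) :
    weightedSum w (fun u => (∑ k, c k * v (u k)) ^ 2) = ∑ k, c k ^ 2 := by
  induction n with
  | zero => simp [weightedSum_zero]
  | succ n ih =>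
    rw [weightedSum_succ']
    simp only [Fin.sum_univ_succ, Fin.cons_zero, Fin.cons_succ, h.sum_affine_sq, weightedSum_add,
      weightedSum_const w h.zero, ih fun k => c k.succ]

lemma HasCumulants.weightedSum_pow_four (c : Fin n → ℝ) :
    weightedSum w (fun u => (∑ k, c k * v (u k)) ^ 4) =
      3 * (∑ k, c k ^ 2) ^ 2 + κ₄ * ∑ k, c k ^ 4 := by
  induction n with
  | zero => simp [weightedSum_zero]
  | succ n ih =>
    rw [weightedSum_succ']
    simp only [Fin.sum_univ_succ, Fin.cons_zero, Fin.cons_succ, h.sum_affine_pow_four,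
      weightedSum_add, weightedSum_mul_left, weightedSum_const w h.zero, ih fun k => c k.succ,
      h.weightedSum_sq fun k => c k.succ]
    ring

/-- Cumulants of independent variables add, so the linear form has cumulants `∑ c ^ 2`, `κ₄ ∑ c ^
4`, `κ₆ ∑ c ^ 6`; this is the sixth moment written in them. The induction peels off one variable. -/
lemma HasCumulants.weightedSum_pow_six (c : Fin n → ℝ) :
    weightedSum w (fun u => (∑ k, c k * v (u k)) ^ 6) =
      15 * (∑ k, c k ^ 2) ^ 3 + 15 * κ₄ * ((∑ k, c k ^ 4) * ∑ k, c k ^ 2) +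
        κ₆ * ∑ k, c k ^ 6 := by
  induction n with
  | zero => simp [weightedSum_zero]
  | succ n ih =>
    have e : ∀ y : ℝ, ∀ c : ℝ, 15 * c ^ 4 * y ^ 2 * (3 + κ₄) = 15 * c ^ 4 * (3 + κ₄) * y ^ 2 :=
      fun y c => by ring
    rw [weightedSum_succ']
    simp only [Fin.sum_univ_succ, Fin.cons_zero, Fin.cons_succ, h.sum_affine_pow_six, e,
      weightedSum_add, weightedSum_mul_left, weightedSum_const w h.zero, ih fun k => c k.succ,
      h.weightedSum_sq fun k => c k.succ, h.weightedSum_pow_four fun k => c k.succ]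
    ring

-- These are the moments of a chi-squared variable with `n` degrees of freedom; only moments of
-- order at most six of each coordinate enter.
omit h in
lemma HasCumulants.weightedSum_normSq_pow (h : HasCumulants w v 0 0) (n : ℕ) :
    weightedSum w (fun u : Fin n → ι => ∑ k, v (u k) ^ 2) = n ∧
    weightedSum w (fun u : Fin n → ι => (∑ k, v (u k) ^ 2) ^ 2) = n * (n + 2) ∧
    weightedSum w (fun u : Fin n → ι => (∑ k, v (u k) ^ 2) ^ 3) = n * (n + 2) * (n + 4) := by
  induction n with
  | zero => simp [weightedSum_zero]
  | succ n ih =>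
    obtain ⟨ih₁, ih₂, ih₃⟩ := ih
    have e₁ : ∀ y, ∑ x, w x * (v x ^ 2 + y) = 1 + y := fun y => by
      simp only [mul_add, Finset.sum_add_distrib, ← Finset.sum_mul, h.zero, h.two, one_mul]
    have e₂ : ∀ y, ∑ x, w x * (v x ^ 2 + y) ^ 2 = 3 + 2 * y + y ^ 2 := fun y => by
      have e : ∀ x, w x * (v x ^ 2 + y) ^ 2 =
        y ^ 2 * w x + 2 * y * (w x * v x ^ 2) + w x * v x ^ 4 := fun x => by ring
      simp only [e, Finset.sum_add_distrib, ← Finset.mul_sum, h.zero, h.two, h.four]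
      ring
    have e₃ : ∀ y, ∑ x, w x * (v x ^ 2 + y) ^ 3 = 15 + 9 * y + 3 * y ^ 2 + y ^ 3 := fun y => by
      have e : ∀ x, w x * (v x ^ 2 + y) ^ 3 = y ^ 3 * w x + 3 * y ^ 2 * (w x * v x ^ 2) +
        3 * y * (w x * v x ^ 4) + w x * v x ^ 6 := fun x => by ring
      simp only [e, Finset.sum_add_distrib, ← Finset.mul_sum, h.zero, h.two, h.four, h.six]
      ring
    simp only [weightedSum_succ', Fin.sum_univ_succ, Fin.cons_zero, Fin.cons_succ, e₁, e₂, e₃,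
      weightedSum_add, weightedSum_mul_left, weightedSum_const w h.zero, ih₁, ih₂, ih₃]
    push_cast
    refine ⟨by ring, by ring, by ring⟩

end WeightedSum

/-! ### Cofactors of the first row -/

/-- The signed maximal minors of an `n × (n + 1)` matrix: the cofactors of a row put on top. -/
def topCofactor {n : ℕ} (A : Fin n → Fin (n + 1) → ℝ) (k : Fin (n + 1)) : ℝ :=
  (Matrix.of (Fin.cons (Pi.single k 1) A : Fin (n + 1) → Fin (n + 1) → ℝ)).det

section Cofactor

variable {n : ℕ}

lemma topCofactor_eq (A : Fin n → Fin (n + 1) → ℝ) (k : Fin (n + 1)) :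
    topCofactor A k = (-1) ^ (k : ℕ) * (Matrix.of fun i j => A i (k.succAbove j)).det := by
  rw [topCofactor, Matrix.det_succ_row_zero, Finset.sum_eq_single k]
  · simp only [Matrix.of_apply, Fin.cons_zero, Pi.single_eq_same, mul_one]
    rfl
  · intro j _ hj
    simp [hj]
  · simp

lemma det_cons_eq_sum_topCofactor (y : Fin (n + 1) → ℝ) (A : Fin n → Fin (n + 1) → ℝ) :
    (Matrix.of (Fin.cons y A : Fin (n + 1) → Fin (n + 1) → ℝ)).det =
      ∑ k, topCofactor A k * y k := by
  rw [Matrix.det_succ_row_zero]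
  refine Finset.sum_congr rfl fun k _ => ?_
  rw [topCofactor_eq]
  simp only [Matrix.of_apply, Fin.cons_zero]
  have : (Matrix.of (Fin.cons y A : Fin (n + 1) → Fin (n + 1) → ℝ)).submatrix Fin.succ
      k.succAbove = Matrix.of fun i j => A i (k.succAbove j) := by
    ext i j; simp
  rw [this]
  ring

lemma topCofactor_comp_perm_sq (A : Fin n → Fin (n + 1) → ℝ) (σ : Equiv.Perm (Fin (n + 1)))
    (k : Fin (n + 1)) : topCofactor (fun i => A i ∘ σ) k ^ 2 = topCofactor A (σ k) ^ 2 := by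
  have : (Matrix.of (Fin.cons (Pi.single k 1) fun i => A i ∘ σ :
        Fin (n + 1) → Fin (n + 1) → ℝ)) =
      (Matrix.of (Fin.cons (Pi.single (σ k) 1) A : Fin (n + 1) → Fin (n + 1) → ℝ)).submatrix
        id σ := by
    ext i j
    refine Fin.cases ?_ (fun i => ?_) i
    · simp [Pi.single_apply]
    · simp
  rw [topCofactor, this, Matrix.det_permute', mul_pow, ← topCofactor]
  rcases Int.units_eq_one_or (Equiv.Perm.sign σ) with h | h <;> simp [h]

lemma topCofactor_cons_zero (c : Fin n → ℝ) (D : Fin n → Fin n → ℝ) :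
    topCofactor (fun i => Fin.cons (c i) (D i)) 0 = (Matrix.of D).det := by
  rw [topCofactor_eq]
  simp only [Fin.val_zero, pow_zero, one_mul, Fin.zero_succAbove, Fin.cons_succ]

/-- The minor is, up to a cyclic permutation of columns, `D` with column `k` replaced by `c`;
Cramer's rule makes it linear in `c`. -/
lemma topCofactor_cons_succ_sq (c : Fin n → ℝ) (D : Fin n → Fin n → ℝ) (k : Fin n) :
    topCofactor (fun i => Fin.cons (c i) (D i)) k.succ ^ 2 =
      (∑ l, (Matrix.of D).adjugate k l * c l) ^ 2 := by
  obtain _ | n := n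
  · exact k.elim0
  have : (Matrix.of fun i j => (Fin.cons (c i) (D i) : Fin (n + 2) → ℝ) (k.succ.succAbove j)) =
      ((Matrix.of D).updateCol k c).submatrix id k.cycleRange.symm := by
    ext i j
    refine Fin.cases ?_ (fun j => ?_) j
    · simp [Fin.cycleRange_symm_zero]
    · simp [Fin.cycleRange_symm_succ, Fin.succ_succAbove_succ, Fin.succAbove_ne]
  rw [topCofactor_eq, this, Matrix.det_permute', ← Matrix.cramer_apply,
    Matrix.cramer_eq_adjugate_mulVec, mul_pow, mul_pow]
  have h₁ : (((Equiv.Perm.sign k.cycleRange.symm : ℤˣ) : ℤ) : ℝ) ^ 2 = 1 := by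
    rcases Int.units_eq_one_or (Equiv.Perm.sign k.cycleRange.symm) with h | h <;> simp [h]
  have h₂ : ((-1 : ℝ) ^ (k.succ : ℕ)) ^ 2 = 1 := by
    rw [← pow_mul, mul_comm, pow_mul]; simp
  rw [h₁, h₂, one_mul, one_mul]
  rfl

lemma adjugate_apply_eq_topCofactor_sq (M : Fin (n + 1) → Fin (n + 1) → ℝ) (k l : Fin (n + 1)) :
    (Matrix.of M).adjugate k l ^ 2 =
      topCofactor (fun i => M (Equiv.swap 0 l i.succ)) k ^ 2 := by
  have : (Matrix.of (Fin.cons (Pi.single k 1) fun i => M (Equiv.swap 0 l (Fin.succ i)) :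
        Fin (n + 1) → Fin (n + 1) → ℝ)) =
      ((Matrix.of M).updateRow l (Pi.single k 1)).submatrix (Equiv.swap 0 l) id := by
    ext i j
    refine Fin.cases ?_ (fun i => ?_) i
    · simp
    · have : Equiv.swap 0 l i.succ ≠ l := by
        intro h
        have := (Equiv.swap 0 l).injective (h.trans (Equiv.swap_apply_left 0 l).symm)
        exact Fin.succ_ne_zero _ this
      simp [this]
  rw [topCofactor, this, Matrix.det_permute, mul_pow, ← Matrix.adjugate_apply]
  rcases Int.units_eq_one_or (Equiv.Perm.sign (Equiv.swap 0 l)) with h | h <;> simp [h]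

end Cofactor

/-! ### Recursions from averaging over a row or a column. -/

section Moments

variable {ι : Type*} [Fintype ι] (w v : ι → ℝ)

lemma weightedSum_prodWeight_reindex {m n : ℕ} (σ : Equiv.Perm (Fin n))
    (g : (Fin m → Fin n → ι) → ℝ) :
    weightedSum (prodWeight w n) (fun a => g fun i => a i ∘ σ) = weightedSum (prodWeight w n) g := by
  let e : (Fin m → Fin n → ι) ≃ (Fin m → Fin n → ι) :=
    Equiv.piCongrRight fun _ => Equiv.arrowCongr σ.symm (Equiv.refl ι)
  have he : ∀ a, e a = fun i => a i ∘ σ := fun a => by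
    ext; simp [e, Equiv.arrowCongr]
  symm
  rw [weightedSum, weightedSum, ← e.sum_comp]
  refine Finset.sum_congr rfl fun a _ => ?_
  rw [he]
  congr 1
  refine Finset.prod_congr rfl fun i _ => ?_
  exact Equiv.prod_comp σ fun j => w (a i j)

/-- The weighted sum of the sixth power of the determinant. -/
def detSixth (n : ℕ) : ℝ :=
  weightedSum (prodWeight w n) fun a : Fin n → Fin n → ι =>
    (Matrix.of fun i j => v (a i j)).det ^ 6

/-- The weighted sum of the fourth power of the determinant times the sum of squared cofactors. -/
def detFourthCofactor (n : ℕ) : ℝ :=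
  weightedSum (prodWeight w n) fun a : Fin n → Fin n → ι =>
    (Matrix.of fun i j => v (a i j)).det ^ 4 *
      ∑ k, ∑ l, (Matrix.of fun i j => v (a i j)).adjugate k l ^ 2

/-- The weighted sum of a function of the vector of maximal minors of an `n × (n + 1)` matrix. -/
def cofactorSum (n : ℕ) (φ : (Fin (n + 1) → ℝ) → ℝ) : ℝ :=
  weightedSum (prodWeight w (n + 1)) fun a : Fin n → Fin (n + 1) → ι =>
    φ (topCofactor fun i j => v (a i j))

omit [Fintype ι] in
lemma of_cons_eq {n : ℕ} (u : Fin (n + 1) → ι) (a : Fin n → Fin (n + 1) → ι) :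
    (Matrix.of fun i j => v ((Fin.cons u a : Fin (n + 1) → Fin (n + 1) → ι) i j)) =
      Matrix.of (Fin.cons (fun j => v (u j)) (fun i j => v (a i j)) :
        Fin (n + 1) → Fin (n + 1) → ℝ) := by
  ext i j
  refine Fin.cases ?_ (fun i => ?_) i <;> simp

omit [Fintype ι] in
lemma det_of_cons {n : ℕ} (u : Fin (n + 1) → ι) (a : Fin n → Fin (n + 1) → ι) :
    (Matrix.of fun i j => v ((Fin.cons u a : Fin (n + 1) → Fin (n + 1) → ι) i j)).det =
      ∑ k, topCofactor (fun i j => v (a i j)) k * v (u k) := by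
  rw [of_cons_eq, det_cons_eq_sum_topCofactor]

variable {w v} {κ₄ κ₆ : ℝ} (h : HasCumulants w v κ₄ κ₆) (n : ℕ)

lemma detSixth_zero : detSixth w v 0 = 1 := by
  simp [detSixth, weightedSum_zero]

lemma detFourthCofactor_zero : detFourthCofactor w v 0 = 0 := by
  simp [detFourthCofactor, weightedSum_zero]

include h

lemma HasCumulants.detSixth_succ_eq_cofactorSum :
    detSixth w v (n + 1) = 15 * cofactorSum w v n (fun c => (∑ k, c k ^ 2) ^ 3) +
      15 * κ₄ * cofactorSum w v n (fun c => (∑ k, c k ^ 4) * ∑ k, c k ^ 2) +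
      κ₆ * cofactorSum w v n (fun c => ∑ k, c k ^ 6) := by
  rw [detSixth, weightedSum_succ']
  simp only [det_of_cons, sum_prodWeight_mul, h.weightedSum_pow_six, weightedSum_add,
    weightedSum_mul_left, cofactorSum]

/-- Minor `0` does not involve the first column, whose total weight is `1`. -/
lemma HasCumulants.cofactorSum_zero_pow_six :
    cofactorSum w v n (fun c => c 0 ^ 6) = detSixth w v n := by
  rw [cofactorSum, weightedSum_prodWeight_succ, detSixth]
  congr 1
  funext D
  rw [← weightedSum_const w h.zero ((Matrix.of fun i j => v (D i j)).det ^ 6) (n := n)]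
  congr 1
  funext c
  rw [← topCofactor_cons_zero (fun i => v (c i))]
  congr 3
  funext i j
  refine Fin.cases ?_ (fun j => ?_) j <;> simp

/-- The other minors are linear forms in the first column with the rows of `adjugate` as
coefficients; averaging their squares leaves the sum of squared coefficients. -/
lemma HasCumulants.cofactorSum_zero_pow_four_mul :
    cofactorSum w v n (fun c => c 0 ^ 4 * ∑ k : Fin n, c k.succ ^ 2) =
      detFourthCofactor w v n := by
  rw [cofactorSum, weightedSum_prodWeight_succ, detFourthCofactor]
  congr 1
  funext D
  have e : ∀ c : Fin n → ι, (fun i j => v ((Fin.cons (c i) (D i) : Fin (n + 1) → ι) j)) =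
      fun i => (Fin.cons (v (c i)) fun j => v (D i j) : Fin (n + 1) → ℝ) := fun c => by
    funext i j
    refine Fin.cases ?_ (fun j => ?_) j <;> simp
  simp only [e, topCofactor_cons_zero, topCofactor_cons_succ_sq, weightedSum_mul_left,
    weightedSum_sum, h.weightedSum_sq]

omit h in
lemma cofactorSum_sum {α : Type*} (s : Finset α) (φ : α → (Fin (n + 1) → ℝ) → ℝ) :
    cofactorSum w v n (fun c => ∑ i ∈ s, φ i c) = ∑ i ∈ s, cofactorSum w v n (φ i) := by
  simp only [cofactorSum, weightedSum_sum]

omit h in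
lemma cofactorSum_comp_perm (σ : Equiv.Perm (Fin (n + 1))) (φ : (Fin (n + 1) → ℝ) → ℝ) :
    cofactorSum w v n (fun c => φ fun k => c (σ k) ^ 2) =
      cofactorSum w v n (fun c => φ fun k => c k ^ 2) := by
  symm
  rw [cofactorSum, cofactorSum, ← weightedSum_prodWeight_reindex w σ]
  congr 1
  funext a
  congr 1
  funext k
  exact topCofactor_comp_perm_sq (fun i j => v (a i j)) σ k

omit h in
-- The squared minors are exchangeable: permuting columns permutes them and preserves the weight.
lemma cofactorSum_swap (j : Fin (n + 1)) (m p : ℕ) :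
    cofactorSum w v n (fun c => c j ^ (2 * m) * (∑ k, c k ^ 2) ^ p) =
      cofactorSum w v n (fun c => c 0 ^ (2 * m) * (∑ k, c k ^ 2) ^ p) := by
  have := cofactorSum_comp_perm (w := w) (v := v) n (Equiv.swap 0 j)
    fun c => c 0 ^ m * (∑ k, c k) ^ p
  simp only [Equiv.swap_apply_left, ← pow_mul] at this
  rw [← this]
  congr 1
  funext c
  congr 2
  exact (Equiv.sum_comp (Equiv.swap 0 j) fun k => c k ^ 2).symm

lemma HasCumulants.cofactorSum_pow_six :
    cofactorSum w v n (fun c => ∑ k, c k ^ 6) = (n + 1) * detSixth w v n := by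
  rw [cofactorSum_sum]
  have := fun j => cofactorSum_swap (w := w) (v := v) n j 3 0
  simp only [pow_zero, mul_one, Nat.reduceMul] at this
  simp [this, h.cofactorSum_zero_pow_six]

lemma HasCumulants.cofactorSum_pow_four_mul :
    cofactorSum w v n (fun c => (∑ k, c k ^ 4) * ∑ k, c k ^ 2) =
      (n + 1) * (detSixth w v n + detFourthCofactor w v n) := by
  simp only [Finset.sum_mul]
  rw [cofactorSum_sum]
  have := fun j => cofactorSum_swap (w := w) (v := v) n j 2 1
  simp only [pow_one, Nat.reduceMul] at this
  have e : (fun c : Fin (n + 1) → ℝ => c 0 ^ 4 * ∑ k, c k ^ 2) =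
      fun c => c 0 ^ 6 + c 0 ^ 4 * ∑ k : Fin n, c k.succ ^ 2 := by
    funext c
    rw [Fin.sum_univ_succ]
    ring
  simp only [this, e, ← h.cofactorSum_zero_pow_six, ← h.cofactorSum_zero_pow_four_mul]
  simp [cofactorSum, weightedSum_add, mul_add]

/-- The cofactors in column `l` of `adjugate` do not involve row `l`. After swapping that row to the
top, averaging over it acts on `det ^ 4` alone, and each of the `n + 1` rows contributes equally. -/
lemma HasCumulants.detFourthCofactor_succ_eq_cofactorSum :
    detFourthCofactor w v (n + 1) = (n + 1) * (3 * cofactorSum w v n (fun c => (∑ k, c k ^ 2) ^ 3) +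
      κ₄ * cofactorSum w v n (fun c => (∑ k, c k ^ 4) * ∑ k, c k ^ 2)) := by
  have key : ∀ l : Fin (n + 1), weightedSum (prodWeight w (n + 1))
      (fun a : Fin (n + 1) → Fin (n + 1) → ι => ∑ k, (Matrix.of fun i j => v (a i j)).det ^ 4 *
        (Matrix.of fun i j => v (a i j)).adjugate k l ^ 2) =
      3 * cofactorSum w v n (fun c => (∑ k, c k ^ 2) ^ 3) +
      κ₄ * cofactorSum w v n (fun c => (∑ k, c k ^ 4) * ∑ k, c k ^ 2) := by
    intro l
    have e : ∀ a : Fin (n + 1) → Fin (n + 1) → ι,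
        ∑ k, (Matrix.of fun i j => v ((a ∘ Equiv.swap 0 l) i j)).det ^ 4 *
          (Matrix.of fun i j => v ((a ∘ Equiv.swap 0 l) i j)).adjugate k l ^ 2 =
        (Matrix.of fun i j => v (a i j)).det ^ 4 *
          ∑ k, topCofactor (fun i j => v (a i.succ j)) k ^ 2 := fun a => by
      have : (Matrix.of fun i j => v ((a ∘ Equiv.swap 0 l) i j)) =
        (Matrix.of fun i j => v (a i j)).submatrix (Equiv.swap 0 l) id := rfl
      have hs : (((Equiv.Perm.sign (Equiv.swap 0 l) : ℤˣ) : ℤ) : ℝ) ^ 4 = 1 := by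
        rcases Int.units_eq_one_or (Equiv.Perm.sign (Equiv.swap 0 l)) with h | h <;> norm_num [h]
      simp only [← Finset.mul_sum, adjugate_apply_eq_topCofactor_sq, Function.comp_apply,
        Equiv.swap_apply_self]
      congr 1
      have := Matrix.det_permute (Equiv.swap 0 l) (Matrix.of fun i j => v (a i j))
      calc _ = ((Matrix.of fun i j => v (a i j)).submatrix (Equiv.swap 0 l) id).det ^ 4 := rfl
        _ = _ := by rw [this, mul_pow, hs, one_mul]
    rw [← weightedSum_reindex _ (Equiv.swap 0 l)]
    simp only [e]
    rw [weightedSum_succ']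
    simp only [det_of_cons, Fin.cons_succ, sum_prodWeight_mul, cofactorSum,
      ← weightedSum_mul_left, ← weightedSum_add]
    congr 1
    funext a
    simp only [mul_comm _ (∑ k, topCofactor (fun i j => v (a i j)) k ^ 2), weightedSum_mul_left,
      h.weightedSum_pow_four]
    ring
  have e : detFourthCofactor w v (n + 1) = weightedSum (prodWeight w (n + 1))
      fun a : Fin (n + 1) → Fin (n + 1) → ι =>
        ∑ l, ∑ k, (Matrix.of fun i j => v (a i j)).det ^ 4 *
          (Matrix.of fun i j => v (a i j)).adjugate k l ^ 2 := by
    rw [detFourthCofactor]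
    congr 1
    funext a
    rw [Finset.sum_comm, Finset.mul_sum]
    simp only [Finset.mul_sum]
  rw [e, weightedSum_sum]
  simp only [key, Finset.sum_const, Finset.card_univ, Fintype.card_fin, nsmul_eq_mul]
  push_cast
  rfl

/-- The term `cofactorSum` of `(∑ c ^ 2) ^ 3`, which has no simple expression at size `n`, is
eliminated between the two row expansions. -/
lemma HasCumulants.detFourthCofactor_succ :
    detFourthCofactor w v (n + 1) =
      (n + 1) * detSixth w v (n + 1) / 5 - κ₆ * (n + 1) ^ 2 * detSixth w v n / 5 -
        2 * κ₄ * (n + 1) ^ 2 * (detSixth w v n + detFourthCofactor w v n) := by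
  have h₁ := h.detSixth_succ_eq_cofactorSum n
  have h₂ := h.detFourthCofactor_succ_eq_cofactorSum n
  rw [h.cofactorSum_pow_four_mul] at h₁ h₂
  rw [h.cofactorSum_pow_six] at h₁
  rw [h₂, h₁]
  ring

end Moments

/-! ### Rotation invariance when the fourth and sixth cumulants vanish -/

/-- Replacing every row at once, given that replacing a single row does not change the weighted
sum. -/
lemma weightedSum_comp_eq_of_update {β X : Type*} [Fintype β] (W : β → ℝ) (p q : β → X) {n : ℕ}
    (G : (Fin n → X) → ℝ)
    (hG : ∀ i Y, ∑ b, W b * G (Function.update Y i (p b)) =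
      ∑ b, W b * G (Function.update Y i (q b))) :
    weightedSum W (fun u => G fun i => p (u i)) = weightedSum W (fun u => G fun i => q (u i)) := by
  induction n with
  | zero =>
    rw [weightedSum_zero, weightedSum_zero]
    congr 1
    exact Subsingleton.elim _ _
  | succ n ih =>
    have hc : ∀ (r : β → X) (x : β) (u : Fin n → β),
        (fun i => r ((Fin.cons x u : Fin (n + 1) → β) i)) =
          (Fin.cons (r x) fun i => r (u i) : Fin (n + 1) → X) := fun r x u => by
      funext i
      refine Fin.cases ?_ (fun i => ?_) i <;> simp
    have h₁ : ∀ x, weightedSum W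
        (fun u : Fin n → β => G (Fin.cons (p x) fun i => p (u i) : Fin (n + 1) → X)) =
        weightedSum W
        (fun u : Fin n → β => G (Fin.cons (p x) fun i => q (u i) : Fin (n + 1) → X)) := fun x => by
      refine ih (fun Y => G (Fin.cons (p x) Y : Fin (n + 1) → X)) fun i Y => ?_
      simpa only [Fin.cons_update] using hG i.succ (Fin.cons (p x) Y)
    have h₂ : ∀ Y : Fin n → X, ∑ x, W x * G (Fin.cons (p x) Y : Fin (n + 1) → X) =
        ∑ x, W x * G (Fin.cons (q x) Y : Fin (n + 1) → X) := fun Y => by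
      obtain _ | ⟨⟨b⟩⟩ := isEmpty_or_nonempty β
      · simp
      · simpa only [Fin.update_cons_zero] using hG 0 (Fin.cons (p b) Y)
    rw [weightedSum_succ]
    simp only [hc, h₁]
    rw [weightedSum_succ']
    simp only [hc, ← h₂, weightedSum_sum, weightedSum_mul_left]

lemma exists_orthogonal_vecMul_eq_single {n : ℕ} (y : Fin (n + 1) → ℝ) :
    ∃ R : Matrix (Fin (n + 1)) (Fin (n + 1)) ℝ,
      R.transpose * R = 1 ∧ Matrix.vecMul y R = Pi.single 0 √(∑ k, y k ^ 2) := by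
  set ρ := √(∑ k, y k ^ 2) with hρ
  have hρ2 : ρ ^ 2 = y ⬝ᵥ y := by
    rw [hρ, Real.sq_sqrt (Finset.sum_nonneg fun _ _ => sq_nonneg _)]
    simp [dotProduct, sq]
  set z := y - Pi.single 0 ρ with hz
  by_cases h0 : z ⬝ᵥ z = 0
  · refine ⟨1, by simp, ?_⟩
    rw [Matrix.vecMul_one, ← sub_eq_zero, ← hz]
    exact dotProduct_self_eq_zero.mp h0
  -- The Householder reflection in the hyperplane orthogonal to `z` exchanges `y` and `ρ e₀`, which
  -- have equal length.
  · refine ⟨1 - (2 / (z ⬝ᵥ z)) • Matrix.vecMulVec z z, ?_, ?_⟩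
    · have ht : (Matrix.vecMulVec z z).transpose = Matrix.vecMulVec z z := by
        ext i j; simp [Matrix.vecMulVec_apply, mul_comm]
      have hm : Matrix.vecMulVec z z * Matrix.vecMulVec z z =
          (z ⬝ᵥ z) • Matrix.vecMulVec z z := by
        ext i j
        simp only [Matrix.mul_apply, Matrix.vecMulVec_apply, Matrix.smul_apply, dotProduct,
          smul_eq_mul, Finset.sum_mul]
        exact Finset.sum_congr rfl fun _ _ => by ring
      rw [Matrix.transpose_sub, Matrix.transpose_one, Matrix.transpose_smul, ht]
      simp only [sub_mul, mul_sub, one_mul, mul_one, Matrix.smul_mul, Matrix.mul_smul, hm, smul_smul,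
        div_mul_cancel₀ _ h0]
      module
    · have h1 : Matrix.vecMul y (Matrix.vecMulVec z z) = (y ⬝ᵥ z) • z := by
        ext j
        simp only [Matrix.vecMul, Matrix.vecMulVec_apply, dotProduct, Pi.smul_apply, smul_eq_mul,
          Finset.sum_mul]
        exact Finset.sum_congr rfl fun _ _ => by ring
      have hyz : y ⬝ᵥ z = ρ ^ 2 - ρ * y 0 := by
        rw [hz, dotProduct_sub, hρ2, dotProduct_single]; ring
      have hzz : z ⬝ᵥ z = 2 * (y ⬝ᵥ z) := by
        have : z ⬝ᵥ z = y ⬝ᵥ z - ρ * z 0 := by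
          conv_lhs => rw [hz, sub_dotProduct, single_dotProduct]
        rw [this, hyz, hz]
        simp only [Pi.sub_apply, Pi.single_eq_same]
        ring
      have hyz0 : y ⬝ᵥ z ≠ 0 := fun h => h0 (by rw [hzz, h, mul_zero])
      rw [Matrix.vecMul_sub, Matrix.vecMul_one, Matrix.vecMul_smul, h1, smul_smul, hzz]
      have : 2 / (2 * (y ⬝ᵥ z)) * (y ⬝ᵥ z) = 1 := by field_simp
      rw [this, one_smul, hz, sub_sub_cancel]

lemma det_updateRow_eq_sum {n : ℕ} (M : Matrix (Fin n) (Fin n) ℝ) (i : Fin n) (x : Fin n → ℝ) :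
    (M.updateRow i x).det = ∑ k, (M.updateRow i (Pi.single k 1)).det * x k := by
  rw [Matrix.det_eq_sum_mul_adjugate_row _ i]
  refine Finset.sum_congr rfl fun k _ => ?_
  rw [Matrix.adjugate_apply, Matrix.updateRow_idem, Matrix.updateRow_self, mul_comm]

section Gaussian

variable {ι : Type*} [Fintype ι] {w v : ι → ℝ} (h : HasCumulants w v 0 0)
include h

/-- The signed law itself need not be rotation invariant. But `det` is a linear form in each row,
and for `κ₄ = κ₆ = 0` the sixth moment of a linear form depends only on the norm of its
coefficients, so the rows can be rotated one at a time until `y` lies on the first axis. -/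
lemma HasCumulants.weightedSum_det_cons_pow_six {n : ℕ} (y : Fin (n + 1) → ℝ) :
    weightedSum (prodWeight w (n + 1)) (fun a : Fin n → Fin (n + 1) → ι =>
      (Matrix.of (Fin.cons y fun i j => v (a i j) : Fin (n + 1) → Fin (n + 1) → ℝ)).det ^ 6) =
      (∑ k, y k ^ 2) ^ 3 * detSixth w v n := by
  obtain ⟨R, hR, hy⟩ := exists_orthogonal_vecMul_eq_single y
  have hdet : R.det ^ 6 = 1 := by
    have := congrArg Matrix.det hR
    rw [Matrix.det_mul, Matrix.det_transpose, Matrix.det_one] at this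
    calc R.det ^ 6 = (R.det * R.det) ^ 3 := by ring
      _ = 1 := by rw [this, one_pow]
  have hrot : ∀ Y : Fin n → Fin (n + 1) → ℝ,
      (Matrix.of (Fin.cons y Y : Fin (n + 1) → Fin (n + 1) → ℝ)).det ^ 6 =
      (Matrix.of (Fin.cons (Pi.single 0 √(∑ k, y k ^ 2)) fun i => Matrix.vecMul (Y i) R :
        Fin (n + 1) → Fin (n + 1) → ℝ)).det ^ 6 := fun Y => by
    have : (Matrix.of (Fin.cons (Pi.single 0 √(∑ k, y k ^ 2)) fun i => Matrix.vecMul (Y i) R :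
        Fin (n + 1) → Fin (n + 1) → ℝ)) =
        (Matrix.of (Fin.cons y Y : Fin (n + 1) → Fin (n + 1) → ℝ)) * R := by
      ext i j
      refine Fin.cases ?_ (fun i => ?_) i
      · rw [← hy]; simp [Matrix.mul_apply, Matrix.vecMul, dotProduct]
      · simp [Matrix.mul_apply, Matrix.vecMul, dotProduct]
    rw [this, Matrix.det_mul, mul_pow, hdet, mul_one]
  simp only [hrot]
  have hinv := weightedSum_comp_eq_of_update (prodWeight w (n + 1))
    (fun b => Matrix.vecMul (fun j => v (b j)) R) (fun b j => v (b j))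
    (fun Y : Fin n → Fin (n + 1) → ℝ =>
      (Matrix.of (Fin.cons (Pi.single 0 √(∑ k, y k ^ 2)) Y :
        Fin (n + 1) → Fin (n + 1) → ℝ)).det ^ 6) ?_
  · rw [hinv]
    simp only [det_cons_eq_sum_topCofactor]
    rw [← h.cofactorSum_zero_pow_six, cofactorSum, ← weightedSum_mul_left]
    congr 1
    funext a
    rw [Finset.sum_eq_single 0 (fun k _ hk => by simp [hk]) (by simp)]
    rw [Pi.single_eq_same, mul_pow, mul_comm]
    congr 1
    have := Real.sq_sqrt (Finset.sum_nonneg fun k (_ : k ∈ Finset.univ) => sq_nonneg (y k))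
    calc _ = (√(∑ k, y k ^ 2) ^ 2) ^ 3 := by ring
      _ = _ := by rw [this]
  · intro i Y
    set M := Matrix.of (Fin.cons (Pi.single 0 √(∑ k, y k ^ 2)) Y : Fin (n + 1) → Fin (n + 1) → ℝ)
    set γ : Fin (n + 1) → ℝ := fun k => (M.updateRow i.succ (Pi.single k 1)).det
    have hM : ∀ x, (Matrix.of (Fin.cons (Pi.single 0 √(∑ k, y k ^ 2)) (Function.update Y i x) :
        Fin (n + 1) → Fin (n + 1) → ℝ)).det = ∑ k, γ k * x k := fun x => by
      rw [← det_updateRow_eq_sum, Fin.cons_update]; rfl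
    simp only [hM, sum_prodWeight_mul]
    have hγ : ∀ b : Fin (n + 1) → ι, ∑ k, γ k * Matrix.vecMul (fun j => v (b j)) R k =
        ∑ k, R.mulVec γ k * v (b k) := fun b => by
      have := Matrix.dotProduct_mulVec (fun j => v (b j)) R γ
      simp only [dotProduct] at this
      simp only [mul_comm (γ _), mul_comm (R.mulVec γ _), this]
    have hn : ∑ k, R.mulVec γ k ^ 2 = ∑ k, γ k ^ 2 := by
      have : R.mulVec γ ⬝ᵥ R.mulVec γ = γ ⬝ᵥ γ := by
        rw [Matrix.dotProduct_mulVec, Matrix.vecMul_mulVec, ← Matrix.dotProduct_mulVec, hR,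
          Matrix.one_mulVec]
      simpa only [dotProduct, ← sq] using this
    have h₁ := h.weightedSum_pow_six (R.mulVec γ)
    have h₂ := h.weightedSum_pow_six γ
    rw [hn] at h₁
    simp only [hγ]
    rw [h₁, h₂]
    ring

lemma HasCumulants.detSixth_succ_of_gaussian (n : ℕ) :
    detSixth w v (n + 1) = (n + 1) * (n + 3) * (n + 5) * detSixth w v n := by
  rw [detSixth, weightedSum_succ]
  simp only [of_cons_eq, h.weightedSum_det_cons_pow_six, sum_prodWeight_mul]
  have := (h.weightedSum_normSq_pow (n + 1)).2.2
  simp only [mul_comm _ (detSixth w v n), weightedSum_mul_left, this]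
  push_cast
  ring

lemma HasCumulants.detSixth_of_gaussian (n : ℕ) :
    detSixth w v n = (1 + n) * (2 + n) * (4 + n).factorial / 48 * (n.factorial : ℝ) ^ 2 := by
  induction n with
  | zero => rw [detSixth_zero]; norm_num [Nat.factorial]
  | succ n ih =>
    rw [h.detSixth_succ_of_gaussian, ih, ← add_assoc, Nat.factorial_succ, Nat.factorial_succ]
    push_cast
    ring

end Gaussian

/-! ### Differentiating along a family of laws -/

lemma weightedSum_comm {ι β : Type*} [Fintype ι] [Fintype β] (w : ι → ℝ) (W : β → ℝ) {m n : ℕ}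
    (g : (Fin m → ι) → (Fin n → β) → ℝ) :
    weightedSum w (fun u => weightedSum W (g u)) =
      weightedSum W fun a => weightedSum w fun u => g u a := by
  simp only [weightedSum, Finset.mul_sum]
  rw [Finset.sum_comm]
  exact Finset.sum_congr rfl fun _ _ => Finset.sum_congr rfl fun _ _ => by ring

lemma hasDerivAt_prodWeight {ι : Type*} {w : ℝ → ι → ℝ} {δ : ι → ℝ} {s : ℝ}
    (hw : ∀ i, HasDerivAt (fun s => w s i) (δ i) s) {n : ℕ} (u : Fin n → ι) :
    HasDerivAt (fun s => prodWeight (w s) n u)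
      (∑ i, (∏ j ∈ Finset.univ.erase i, w s (u j)) * δ (u i)) s := by
  simpa only [smul_eq_mul, prodWeight, Finset.prod_apply] using
    HasDerivAt.fun_finsetProd (u := Finset.univ) fun i _ => hw (u i)

/-- The product rule gives `n + 1` terms; symmetry of `g` moves the differentiated factor to
position `0` in each. -/
lemma hasDerivAt_weightedSum_of_symmetric {ι : Type*} [Fintype ι] {w : ℝ → ι → ℝ} {δ : ι → ℝ}
    {s : ℝ} (hw : ∀ i, HasDerivAt (fun s => w s i) (δ i) s) {n : ℕ} (g : (Fin (n + 1) → ι) → ℝ)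
    (hg : ∀ i u, g (u ∘ Equiv.swap 0 i) = g u) :
    HasDerivAt (fun s => weightedSum (w s) g)
      ((n + 1) * weightedSum (w s) fun u : Fin n → ι => ∑ x, δ x * g (Fin.cons x u)) s := by
  have hd : HasDerivAt (fun s => weightedSum (w s) g)
      (∑ u, (∑ i, (∏ j ∈ Finset.univ.erase i, w s (u j)) * δ (u i)) * g u) s :=
    HasDerivAt.fun_sum fun u _ => (hasDerivAt_prodWeight hw u).mul_const (g u)
  convert hd using 1
  have hT : ∀ i : Fin (n + 1),
      ∑ u : Fin (n + 1) → ι, (∏ j ∈ Finset.univ.erase i, w s (u j)) * δ (u i) * g u =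
      ∑ u : Fin (n + 1) → ι, (∏ j ∈ Finset.univ.erase 0, w s (u j)) * δ (u 0) * g u := fun i => by
    rw [← (Equiv.arrowCongr (Equiv.swap 0 i).symm (Equiv.refl ι)).sum_comp]
    refine Finset.sum_congr rfl fun u _ => ?_
    have hu : Equiv.arrowCongr (Equiv.swap 0 i).symm (Equiv.refl ι) u = u ∘ Equiv.swap 0 i := by
      ext; simp [Equiv.arrowCongr]
    rw [hu, hg, Function.comp_apply, Equiv.swap_apply_right]
    congr 2
    refine Finset.prod_equiv (Equiv.swap 0 i) (fun j => ?_) fun _ _ => rfl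
    simp [Equiv.swap_apply_eq_iff]
  have h0 : ∑ u : Fin (n + 1) → ι, (∏ j ∈ Finset.univ.erase 0, w s (u j)) * δ (u 0) * g u =
      weightedSum (w s) fun u : Fin n → ι => ∑ x, δ x * g (Fin.cons x u) := by
    have he : (Finset.univ.erase 0 : Finset (Fin (n + 1))) =
        Finset.univ.map (Fin.succEmb n) := by
      ext j
      simp [Fin.exists_succ_eq]
    rw [← (Fin.consEquiv fun _ : Fin (n + 1) => ι).sum_comp, Fintype.sum_prod_type,
      Finset.sum_comm, weightedSum]
    refine Finset.sum_congr rfl fun u _ => ?_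
    rw [Finset.mul_sum]
    refine Finset.sum_congr rfl fun x _ => ?_
    simp [Fin.consEquiv, he, mul_assoc]
  simp only [Finset.sum_mul]
  rw [Finset.sum_comm]
  simp only [hT, h0]
  simp

/-- The direction `δ` in which only the fourth and the sixth moment change. -/
structure IsMomentDirection {ι : Type*} [Fintype ι] (δ v : ι → ℝ) (d₄ d₆ : ℝ) : Prop where
  zero : ∑ i, δ i = 0
  one : ∑ i, δ i * v i = 0
  two : ∑ i, δ i * v i ^ 2 = 0
  three : ∑ i, δ i * v i ^ 3 = 0
  four : ∑ i, δ i * v i ^ 4 = d₄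
  five : ∑ i, δ i * v i ^ 5 = 0
  six : ∑ i, δ i * v i ^ 6 = d₆

section Derivative

variable {ι : Type*} [Fintype ι] {v δ : ι → ℝ} {d₄ d₆ : ℝ} (hδ : IsMomentDirection δ v d₄ d₆)

include hδ in
lemma IsMomentDirection.sum_affine_pow_six (c y : ℝ) :
    ∑ x, δ x * (c * v x + y) ^ 6 = d₆ * c ^ 6 + 15 * d₄ * c ^ 4 * y ^ 2 := by
  have e : ∀ x, δ x * (c * v x + y) ^ 6 =
      y ^ 6 * δ x + 6 * c * y ^ 5 * (δ x * v x) + 15 * c ^ 2 * y ^ 4 * (δ x * v x ^ 2) +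
        20 * c ^ 3 * y ^ 3 * (δ x * v x ^ 3) + 15 * c ^ 4 * y ^ 2 * (δ x * v x ^ 4) +
        6 * c ^ 5 * y * (δ x * v x ^ 5) + c ^ 6 * (δ x * v x ^ 6) := fun x => by ring
  simp only [e, Finset.sum_add_distrib, ← Finset.mul_sum, hδ.zero, hδ.one, hδ.two, hδ.three,
    hδ.four, hδ.five, hδ.six]
  ring

lemma det_of_perm_pow_six {n : ℕ} (M : Matrix (Fin n) (Fin n) ℝ) (σ τ : Equiv.Perm (Fin n)) :
    (M.submatrix σ τ).det ^ 6 = M.det ^ 6 := by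
  have : M.submatrix σ τ = (M.submatrix σ id).submatrix id τ := rfl
  rw [this, Matrix.det_permute', Matrix.det_permute, mul_pow, mul_pow]
  rcases Int.units_eq_one_or (Equiv.Perm.sign σ) with h | h <;>
  rcases Int.units_eq_one_or (Equiv.Perm.sign τ) with h' | h' <;> norm_num [h, h']

-- The symmetric product rule is used over rows and then over the entries of a row, so all `(n + 1)
-- ^ 2` entries contribute like entry `(0, 0)`. There `det = c₀ x + y`, and `δ` sees only the terms
-- in `x ^ 4` and `x ^ 6`; averaging `y ^ 2` over the rest of the row gives the remaining squared
-- minors.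
include hδ in
lemma HasCumulants.hasDerivAt_detSixth {w : ℝ → ι → ℝ} {s : ℝ} {κ₄ κ₆ : ℝ}
    (h : HasCumulants (w s) v κ₄ κ₆) (hw : ∀ i, HasDerivAt (fun s => w s i) (δ i) s) (n : ℕ) :
    HasDerivAt (fun s => detSixth (w s) v (n + 1))
      ((n + 1) ^ 2 * (d₆ * detSixth (w s) v n + 15 * d₄ * detFourthCofactor (w s) v n)) s := by
  have h₁ := hasDerivAt_weightedSum_of_symmetric (w := fun s => prodWeight (w s) (n + 1))
    (fun r => hasDerivAt_prodWeight hw r)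
    (fun a : Fin (n + 1) → Fin (n + 1) → ι => (Matrix.of fun i j => v (a i j)).det ^ 6)
    fun i a => det_of_perm_pow_six (Matrix.of fun i j => v (a i j)) (Equiv.swap 0 i) 1
  refine h₁.congr_deriv ?_
  rw [weightedSum_sum]
  simp only [weightedSum_mul_left]
  set H : (Fin (n + 1) → ι) → ℝ := fun r => weightedSum (prodWeight (w s) (n + 1))
    fun a : Fin n → Fin (n + 1) → ι =>
      (Matrix.of fun i j => v ((Fin.cons r a : Fin (n + 1) → Fin (n + 1) → ι) i j)).det ^ 6
    with hH
  have hHsymm : ∀ i r, H (r ∘ Equiv.swap 0 i) = H r := fun i r => by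
    rw [hH]
    simp only
    rw [← weightedSum_prodWeight_reindex (w s) (Equiv.swap 0 i)]
    congr 1
    funext a
    rw [← det_of_perm_pow_six _ 1 (Equiv.swap 0 i)]
    congr 2
    ext k l
    refine Fin.cases ?_ (fun k => ?_) k <;> simp
  have h₂ := hasDerivAt_weightedSum_of_symmetric hw H hHsymm
  have h₃ : HasDerivAt (fun s => weightedSum (w s) H) (∑ r : Fin (n + 1) → ι,
      (∑ i, (∏ j ∈ Finset.univ.erase i, w s (r j)) * δ (r i)) * H r) s :=
    HasDerivAt.fun_sum fun r _ => (hasDerivAt_prodWeight hw r).mul_const (H r)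
  -- With `H` frozen at `s`, both the raw and the symmetrised product rule compute the same
  -- derivative; uniqueness equates the two expressions.
  rw [h₃.unique h₂, hH]
  simp only [← weightedSum_mul_left, ← weightedSum_sum]
  rw [weightedSum_comm]
  simp only [det_of_cons, Fin.sum_univ_succ, Fin.cons_zero, Fin.cons_succ,
    hδ.sum_affine_pow_six, weightedSum_add, weightedSum_mul_left, weightedSum_const _ h.zero,
    h.weightedSum_sq]
  rw [← h.cofactorSum_zero_pow_six, ← h.cofactorSum_zero_pow_four_mul, cofactorSum, cofactorSum]
  simp only [mul_assoc, weightedSum_mul_left]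
  ring

end Derivative

/-! ### A signed law with prescribed cumulants -/

/-- The support of the signed laws. -/
noncomputable def lawPoint : Fin 7 → ℝ := ![0, 1, -1, 2, -2, 3, -3]

/-- The weights on the points `0, ±1, ±2, ±3` with fourth cumulant `κ₄` and sixth cumulant `κ₆`. -/
noncomputable def lawWeight (κ₄ κ₆ : ℝ) : Fin 7 → ℝ :=
  ![(14 - κ₄ - κ₆) / 36, (12 + 2 * κ₄ + κ₆) / 48, (12 + 2 * κ₄ + κ₆) / 48,
    (6 - 5 * κ₄ - κ₆) / 120, (6 - 5 * κ₄ - κ₆) / 120,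
    (4 + 10 * κ₄ + κ₆) / 720, (4 + 10 * κ₄ + κ₆) / 720]

/-- Symmetry kills the odd moments, and the four free weights solve the linear system for moments
`0, 2, 4, 6`. They are affine in the cumulants and may be negative. -/
lemma hasCumulants_lawWeight (κ₄ κ₆ : ℝ) :
    HasCumulants (lawWeight κ₄ κ₆) lawPoint κ₄ κ₆ := by
  constructor <;> simp [lawWeight, lawPoint, Fin.sum_univ_succ] <;> ring

/-- The direction in which the cumulants of `lawWeight` move with velocity `(κ₄, κ₆)`. -/
noncomputable def lawDirection (κ₄ κ₆ : ℝ) (i : Fin 7) : ℝ := lawWeight κ₄ κ₆ i - lawWeight 0 0 i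

lemma isMomentDirection_lawDirection (κ₄ κ₆ : ℝ) :
    IsMomentDirection (lawDirection κ₄ κ₆) lawPoint κ₄ (κ₆ + 15 * κ₄) := by
  have h := hasCumulants_lawWeight κ₄ κ₆
  have h' := hasCumulants_lawWeight 0 0
  constructor <;> simp only [lawDirection, sub_mul, Finset.sum_sub_distrib, h.zero, h.one, h.two,
    h.three, h.four, h.five, h.six, h'.zero, h'.one, h'.two, h'.three, h'.four, h'.five, h'.six] <;>
    ring

lemma lawWeight_smul (κ₄ κ₆ s : ℝ) (i : Fin 7) :
    lawWeight (s * κ₄) (s * κ₆) i = lawWeight 0 0 i + s * lawDirection κ₄ κ₆ i := by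
  fin_cases i <;> simp [lawDirection, lawWeight] <;> ring

lemma hasDerivAt_lawWeight (κ₄ κ₆ s : ℝ) (i : Fin 7) :
    HasDerivAt (fun s => lawWeight (s * κ₄) (s * κ₆) i) (lawDirection κ₄ κ₆ i) s := by
  simp only [lawWeight_smul]
  simpa using ((hasDerivAt_id s).mul_const (lawDirection κ₄ κ₆ i)).const_add (lawWeight 0 0 i)

/-! ### Power series solutions of the recursion -/

/-- The geometric series `1 / (1 - κ t)`. -/
noncomputable def geomSeries (κ : ℝ) : PowerSeries ℝ := PowerSeries.mk fun n => κ ^ n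

/-- The derivative with respect to a parameter, coefficient by coefficient. -/
def HasCoeffDerivAt (A : ℝ → PowerSeries ℝ) (A' : PowerSeries ℝ) (s : ℝ) : Prop :=
  ∀ n, HasDerivAt (fun s => PowerSeries.coeff n (A s)) (PowerSeries.coeff n A') s

section PowerSeries

open PowerSeries

variable {A B : ℝ → PowerSeries ℝ} {A' B' : PowerSeries ℝ} {s : ℝ}

lemma HasCoeffDerivAt.const (P : PowerSeries ℝ) : HasCoeffDerivAt (fun _ => P) 0 s := fun n => by
  simpa using hasDerivAt_const s (coeff n P)

lemma HasCoeffDerivAt.mul (hA : HasCoeffDerivAt A A' s) (hB : HasCoeffDerivAt B B' s) :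
    HasCoeffDerivAt (fun s => A s * B s) (A' * B s + A s * B') s := fun n => by
  simp only [map_add, coeff_mul, ← Finset.sum_add_distrib]
  exact HasDerivAt.fun_sum fun p _ => (hA p.1).mul (hB p.2)

lemma HasCoeffDerivAt.pow (hA : HasCoeffDerivAt A A' s) (k : ℕ) :
    HasCoeffDerivAt (fun s => A s ^ (k + 1)) ((k + 1 : ℕ) * A s ^ k * A') s := by
  induction k with
  | zero => simpa using hA
  | succ k ih =>
    have := ih.mul hA
    simp only [← pow_succ] at this
    convert this using 1
    push_cast
    ring

lemma HasCoeffDerivAt.sum {α : Type*} {t : Finset α} {F : α → ℝ → PowerSeries ℝ}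
    {F' : α → PowerSeries ℝ} (hF : ∀ i ∈ t, HasCoeffDerivAt (F i) (F' i) s) :
    HasCoeffDerivAt (fun s => ∑ i ∈ t, F i s) (∑ i ∈ t, F' i) s := fun n => by
  simp only [map_sum]
  exact HasDerivAt.fun_sum fun i hi => hF i hi n

lemma geomSeries_mul (κ : ℝ) : geomSeries κ * (1 - C κ * X) = 1 := by
  ext n
  obtain _ | n := n
  · simp [geomSeries]
  · rw [mul_sub, mul_one, ← mul_assoc, map_sub, coeff_succ_mul_X, coeff_mul_C]
    simp [geomSeries, pow_succ, coeff_one]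

lemma coeff_geomSeries_sq (κ : ℝ) (n : ℕ) : coeff n (geomSeries κ ^ 2) = (n + 1) * κ ^ n := by
  rw [sq, coeff_mul, Finset.sum_congr rfl (g := fun _ => κ ^ n) fun p hp => ?_]
  · simp
  · rw [geomSeries, coeff_mk, coeff_mk, ← pow_add, Finset.HasAntidiagonal.mem_antidiagonal.mp hp]

lemma derivative_geomSeries (κ : ℝ) :
    derivative ℝ (geomSeries κ) = C κ * geomSeries κ ^ 2 := by
  ext n
  rw [coeff_derivative, coeff_C_mul, coeff_geomSeries_sq, geomSeries, coeff_mk]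
  ring

lemma coeff_formalExp (κ : ℝ) (n : ℕ) : coeff n (formalExp κ) = κ ^ n / n.factorial := by
  simp [formalExp, coeff_rescale, coeff_exp, div_eq_mul_inv]

lemma derivative_formalExp (κ : ℝ) : derivative ℝ (formalExp κ) = C κ * formalExp κ := by
  ext n
  rw [coeff_derivative, coeff_C_mul, coeff_formalExp, coeff_formalExp, Nat.factorial_succ]
  have : (n.factorial : ℝ) ≠ 0 := by positivity
  push_cast
  field_simp
  ring

lemma hasCoeffDerivAt_geomSeries (κ : ℝ) :
    HasCoeffDerivAt (fun s => geomSeries (s * κ))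
      (C κ * X * geomSeries (s * κ) ^ 2) s := fun n => by
  simp only [geomSeries, coeff_mk]
  obtain _ | n := n
  · simp [hasDerivAt_const]
  · rw [mul_assoc, coeff_C_mul, coeff_succ_X_mul, ← geomSeries, coeff_geomSeries_sq]
    refine (((hasDerivAt_id s).mul_const κ).fun_pow (n + 1)).congr_deriv ?_
    simp
    ring

lemma hasCoeffDerivAt_formalExp (κ : ℝ) :
    HasCoeffDerivAt (fun s => formalExp (s * κ)) (C κ * X * formalExp (s * κ)) s := fun n => by
  simp only [coeff_formalExp]
  obtain _ | n := n
  · simp [hasDerivAt_const]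
  · rw [mul_assoc, coeff_C_mul, coeff_succ_X_mul, coeff_formalExp]
    refine ((((hasDerivAt_id s).mul_const κ).fun_pow (n + 1)).div_const
      ((n + 1).factorial : ℝ)).congr_deriv ?_
    have : (n.factorial : ℝ) ≠ 0 := by positivity
    rw [Nat.factorial_succ]
    push_cast
    simp
    field_simp

/-- The `r`-th summand of the generating function of the sixth moments, up to a constant. -/
noncomputable def sixthTerm (κ₄ κ₆ : ℝ) (r : ℕ) : PowerSeries ℝ :=
  X ^ r * (formalExp κ₆ * geomSeries κ₄ ^ (14 + 3 * r + 1))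

/-- The companion of `sixthTerm` for the mixed moments of determinant and cofactors. -/
noncomputable def cofactorTerm (κ₄ κ₆ : ℝ) (r : ℕ) : PowerSeries ℝ :=
  (C κ₄ * X + C ((r : ℝ) / 5)) * geomSeries κ₄ * sixthTerm κ₄ κ₆ r

lemma X_mul_derivative_X_pow (r : ℕ) :
    (X : PowerSeries ℝ) * derivative ℝ (X ^ r : PowerSeries ℝ) = C (r : ℝ) * X ^ r := by
  obtain _ | r := r
  · simp
  · rw [Derivation.leibniz_pow, derivative_X]
    simp [pow_succ]
    ring

/-- Generating-function form of `HasCumulants.detFourthCofactor_succ`. Solving it for the companion,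
a factor `1 + 2 κ₄ X` cancels, which explains the shape of `cofactorTerm`. -/
lemma cofactorTerm_eq (κ₄ κ₆ : ℝ) (r : ℕ) :
    cofactorTerm κ₄ κ₆ r = C (1 / 5) * (X * derivative ℝ (sixthTerm κ₄ κ₆ r)) -
      C (κ₆ / 5) * (X * sixthTerm κ₄ κ₆ r) -
      C (2 * κ₄) * (X * (sixthTerm κ₄ κ₆ r + cofactorTerm κ₄ κ₆ r)) := by
  have hV := geomSeries_mul κ₄
  have h₁ : X * derivative ℝ (sixthTerm κ₄ κ₆ r) = (C (r : ℝ) + C κ₆ * X +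
      C (15 + 3 * (r : ℝ)) * C κ₄ * X * geomSeries κ₄) * sixthTerm κ₄ κ₆ r := by
    rw [sixthTerm, Derivation.leibniz, Derivation.leibniz, Derivation.leibniz_pow,
      derivative_geomSeries, derivative_formalExp]
    simp only [smul_eq_mul, nsmul_eq_mul, Nat.add_sub_cancel]
    have := X_mul_derivative_X_pow r
    have hc : ((14 + 3 * r + 1 : ℕ) : PowerSeries ℝ) = C (15 + 3 * (r : ℝ)) := by
      rw [← map_natCast (C : ℝ →+* PowerSeries ℝ)]
      congr 1
      push_cast
      ring
    rw [hc]
    linear_combination (formalExp κ₆ * geomSeries κ₄ ^ (14 + 3 * r + 1)) * this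
  have h5 : (C (1 / 5 : ℝ) : PowerSeries ℝ) * 5 = 1 := by
    rw [show (5 : PowerSeries ℝ) = C 5 from (map_ofNat _ 5).symm, ← map_mul]
    norm_num
  have e₁ : (C (15 + 3 * (r : ℝ)) : PowerSeries ℝ) = 15 + 3 * C (r : ℝ) := by
    rw [map_add, map_mul, map_ofNat, map_ofNat]
  have e₂ : (C ((r : ℝ) / 5) : PowerSeries ℝ) = C (1 / 5) * C (r : ℝ) := by
    rw [← map_mul]; congr 1; ring
  have e₃ : (C (κ₆ / 5) : PowerSeries ℝ) = C (1 / 5) * C κ₆ := by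
    rw [← map_mul]; congr 1; ring
  have e₄ : (C (2 * κ₄) : PowerSeries ℝ) = 2 * C κ₄ := by
    rw [map_mul, map_ofNat]
  rw [h₁, cofactorTerm, e₁, e₂, e₃, e₄]
  generalize (C (1 / 5 : ℝ) : PowerSeries ℝ) = a at *
  generalize (C κ₄ : PowerSeries ℝ) = k at *
  generalize (C (r : ℝ) : PowerSeries ℝ) = q at *
  generalize sixthTerm κ₄ κ₆ r = F at *
  generalize geomSeries κ₄ = V at *
  linear_combination (a * q - 2 * k * X) * F * hV - 3 * F * k * X * V * h5

/-- Counterpart of `HasCumulants.hasDerivAt_detSixth`; the constant `κ₆ + 15 κ₄` is the velocity of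
the sixth moment. -/
lemma hasCoeffDerivAt_sixthTerm (κ₄ κ₆ : ℝ) (r : ℕ) :
    HasCoeffDerivAt (fun s => sixthTerm (s * κ₄) (s * κ₆) r)
      (X * (C (κ₆ + 15 * κ₄) * sixthTerm (s * κ₄) (s * κ₆) r +
        C (15 * κ₄) * cofactorTerm (s * κ₄) (s * κ₆) r)) s := by
  have := (HasCoeffDerivAt.const (s := s) (X ^ r)).mul
    ((hasCoeffDerivAt_formalExp (s := s) κ₆).mul
      ((hasCoeffDerivAt_geomSeries (s := s) κ₄).pow (14 + 3 * r)))
  have hV := geomSeries_mul (s * κ₄)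
  have hc : ((14 + 3 * r + 1 : ℕ) : PowerSeries ℝ) = 15 + 3 * C (r : ℝ) := by
    simp
    ring
  have h5 : (C (1 / 5 : ℝ) : PowerSeries ℝ) * 5 = 1 := by
    rw [show (5 : PowerSeries ℝ) = C 5 from (map_ofNat _ 5).symm, ← map_mul]
    norm_num
  have e₁ : (C (κ₆ + 15 * κ₄) : PowerSeries ℝ) = C κ₆ + 15 * C κ₄ := by
    rw [map_add, map_mul, map_ofNat]
  have e₂ : (C ((r : ℝ) / 5) : PowerSeries ℝ) = C (1 / 5) * C (r : ℝ) := by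
    rw [← map_mul]; congr 1; ring
  have e₄ : (C (15 * κ₄) : PowerSeries ℝ) = 15 * C κ₄ := by
    rw [map_mul, map_ofNat]
  refine fun n => (this n).congr_deriv (congrArg (coeff n) ?_)
  rw [hc, cofactorTerm, e₁, e₂, e₄, sixthTerm]
  generalize (C (1 / 5 : ℝ) : PowerSeries ℝ) = a at *
  generalize (C κ₄ : PowerSeries ℝ) = k at *
  generalize (C κ₆ : PowerSeries ℝ) = l at *
  generalize (C (r : ℝ) : PowerSeries ℝ) = q at *
  generalize geomSeries (s * κ₄) = V at *
  generalize formalExp (s * κ₆) = E at *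
  linear_combination (-3 * X * k * q * V ^ (14 + 3 * r + 2) * X ^ r * E) * h5 +
    15 * X * k * V ^ (14 + 3 * r + 1) * X ^ r * E * hV

end PowerSeries

/-! ### Finite partial sums of the solution and their identification with the moments. -/

section Truncated

open PowerSeries

/-- The coefficients of the generating function for Gaussian entries. -/
noncomputable def gaussianCoeff (r : ℕ) : ℝ := (1 + r) * (2 + r) * (4 + r).factorial / 48

/-- The generating function of the sixth moments, summed over `r < N`. -/
noncomputable def sixthPartial (N : ℕ) (κ₄ κ₆ : ℝ) : PowerSeries ℝ :=
  ∑ r ∈ Finset.range N, C (gaussianCoeff r) * sixthTerm κ₄ κ₆ r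

/-- The companion of `sixthPartial` for the mixed moments of determinant and cofactors. -/
noncomputable def cofactorPartial (N : ℕ) (κ₄ κ₆ : ℝ) : PowerSeries ℝ :=
  ∑ r ∈ Finset.range N, C (gaussianCoeff r) * cofactorTerm κ₄ κ₆ r

lemma cofactorPartial_eq (N : ℕ) (κ₄ κ₆ : ℝ) :
    cofactorPartial N κ₄ κ₆ = C (1 / 5) * (X * derivative ℝ (sixthPartial N κ₄ κ₆)) -
      C (κ₆ / 5) * (X * sixthPartial N κ₄ κ₆) -
      C (2 * κ₄) * (X * (sixthPartial N κ₄ κ₆ + cofactorPartial N κ₄ κ₆)) := by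
  simp only [cofactorPartial, sixthPartial, map_sum, ← Finset.sum_add_distrib, Finset.mul_sum,
    ← Finset.sum_sub_distrib]
  refine Finset.sum_congr rfl fun r _ => ?_
  have : derivative ℝ (C (gaussianCoeff r) * sixthTerm κ₄ κ₆ r) =
      C (gaussianCoeff r) * derivative ℝ (sixthTerm κ₄ κ₆ r) := by
    rw [← smul_eq_C_mul, Derivation.map_smul, smul_eq_C_mul]
  rw [this]
  linear_combination C (gaussianCoeff r) * cofactorTerm_eq κ₄ κ₆ r

lemma coeff_succ_cofactorPartial (N n : ℕ) (κ₄ κ₆ : ℝ) :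
    coeff (n + 1) (cofactorPartial N κ₄ κ₆) =
      (n + 1) * coeff (n + 1) (sixthPartial N κ₄ κ₆) / 5 -
        κ₆ * coeff n (sixthPartial N κ₄ κ₆) / 5 -
        2 * κ₄ * (coeff n (sixthPartial N κ₄ κ₆) + coeff n (cofactorPartial N κ₄ κ₆)) := by
  conv_lhs => rw [cofactorPartial_eq]
  simp only [map_sub, coeff_C_mul, coeff_succ_X_mul, coeff_derivative, map_add]
  ring

lemma coeff_zero_cofactorPartial (N : ℕ) (κ₄ κ₆ : ℝ) :
    coeff 0 (cofactorPartial N κ₄ κ₆) = 0 := by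
  rw [cofactorPartial_eq]
  simp

lemma hasCoeffDerivAt_sixthPartial (N : ℕ) (κ₄ κ₆ s : ℝ) :
    HasCoeffDerivAt (fun s => sixthPartial N (s * κ₄) (s * κ₆))
      (X * (C (κ₆ + 15 * κ₄) * sixthPartial N (s * κ₄) (s * κ₆) +
        C (15 * κ₄) * cofactorPartial N (s * κ₄) (s * κ₆))) s := by
  have : X * (C (κ₆ + 15 * κ₄) * sixthPartial N (s * κ₄) (s * κ₆) +
        C (15 * κ₄) * cofactorPartial N (s * κ₄) (s * κ₆)) =
      ∑ r ∈ Finset.range N, (0 * sixthTerm (s * κ₄) (s * κ₆) r + C (gaussianCoeff r) *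
        (X * (C (κ₆ + 15 * κ₄) * sixthTerm (s * κ₄) (s * κ₆) r +
          C (15 * κ₄) * cofactorTerm (s * κ₄) (s * κ₆) r))) := by
    simp only [cofactorPartial, sixthPartial, Finset.mul_sum, ← Finset.sum_add_distrib]
    exact Finset.sum_congr rfl fun r _ => by ring
  rw [this]
  exact HasCoeffDerivAt.sum fun r _ =>
    (HasCoeffDerivAt.const _).mul (hasCoeffDerivAt_sixthTerm κ₄ κ₆ r)

lemma sixthTerm_zero_zero (r : ℕ) : sixthTerm 0 0 r = X ^ r := by
  have h₁ : geomSeries 0 = 1 := by simpa using geomSeries_mul 0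
  have h₂ : formalExp 0 = 1 := by
    ext n
    rw [coeff_formalExp, coeff_one]
    obtain _ | n := n <;> simp
  rw [sixthTerm, h₁, h₂, one_pow, mul_one, mul_one]

lemma coeff_sixthPartial_zero_zero {N n : ℕ} (hn : n < N) :
    coeff n (sixthPartial N 0 0) = gaussianCoeff n := by
  simp [sixthPartial, sixthTerm_zero_zero, coeff_X_pow, hn]

lemma coeff_zero_sixthPartial {N : ℕ} (hN : 0 < N) (κ₄ κ₆ : ℝ) :
    coeff 0 (sixthPartial N κ₄ κ₆) = 1 := by
  rw [sixthPartial, map_sum, Finset.sum_eq_single 0]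
  · have hV : constantCoeff (geomSeries κ₄) = 1 := by simp [geomSeries]
    have hE : constantCoeff (formalExp κ₆) = 1 := by
      rw [← coeff_zero_eq_constantCoeff_apply, coeff_formalExp]
      simp
    have hg : gaussianCoeff 0 = 1 := by norm_num [gaussianCoeff, Nat.factorial]
    simp [sixthTerm, hV, hE, hg]
  · intro r _ hr
    simp [sixthTerm, hr]
  · intro h
    simp [hN.ne'] at h

/-- The normalized sixth moments and mixed moments are the coefficients of the two series. -/
lemma detSixth_eq_coeff (κ₄ κ₆ : ℝ) {N : ℕ} (n : ℕ) (hn : n < N) (s : ℝ) :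
    detSixth (lawWeight (s * κ₄) (s * κ₆)) lawPoint n =
        (n.factorial : ℝ) ^ 2 * coeff n (sixthPartial N (s * κ₄) (s * κ₆)) ∧
      detFourthCofactor (lawWeight (s * κ₄) (s * κ₆)) lawPoint n =
        (n.factorial : ℝ) ^ 2 * coeff n (cofactorPartial N (s * κ₄) (s * κ₆)) := by
  induction n generalizing s with
  | zero =>
    simp only [detSixth_zero, detFourthCofactor_zero, coeff_zero_cofactorPartial,
      coeff_zero_sixthPartial hn]
    simp
  | succ n ih =>
    replace ih := fun s => ih (by omega) s
    have hfact : ((n + 1).factorial : ℝ) = (n + 1) * n.factorial := by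
      rw [Nat.factorial_succ]; push_cast; rfl
    -- Both derivatives are the same combination of size-`n` quantities at the same `s`, hence the
    -- induction hypothesis for every `s`.
    have hderiv : ∀ s, HasDerivAt (fun s =>
        detSixth (lawWeight (s * κ₄) (s * κ₆)) lawPoint (n + 1) -
        ((n + 1).factorial : ℝ) ^ 2 * coeff (n + 1) (sixthPartial N (s * κ₄) (s * κ₆))) 0 s :=
      fun s => by
      refine ((HasCumulants.hasDerivAt_detSixth (w := fun s => lawWeight (s * κ₄) (s * κ₆))
        (isMomentDirection_lawDirection κ₄ κ₆) (hasCumulants_lawWeight (s * κ₄) (s * κ₆))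
        (hasDerivAt_lawWeight κ₄ κ₆ s) n).sub
        ((hasCoeffDerivAt_sixthPartial N κ₄ κ₆ s (n + 1)).const_mul _)).congr_deriv ?_
      rw [(ih s).1, (ih s).2, coeff_succ_X_mul, map_add, coeff_C_mul, coeff_C_mul, hfact]
      ring
    have hconst := is_const_of_deriv_eq_zero (fun s => (hderiv s).differentiableAt)
      fun s => (hderiv s).deriv
    have h₁ : ∀ s, detSixth (lawWeight (s * κ₄) (s * κ₆)) lawPoint (n + 1) =
        ((n + 1).factorial : ℝ) ^ 2 * coeff (n + 1) (sixthPartial N (s * κ₄) (s * κ₆)) :=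
      fun s => by
      have := hconst s 0
      -- The constant difference is evaluated at `s = 0`, where the Gaussian formula makes it
      -- vanish.
      simp only [zero_mul] at this
      rw [coeff_sixthPartial_zero_zero hn, (hasCumulants_lawWeight 0 0).detSixth_of_gaussian,
        gaussianCoeff] at this
      linear_combination this
    refine ⟨h₁ s, ?_⟩
    rw [(hasCumulants_lawWeight (s * κ₄) (s * κ₆)).detFourthCofactor_succ, h₁ s, (ih s).1, (ih s).2,
      coeff_succ_cofactorPartial, hfact]
    ring

end Truncated

/-! ### Determinant moments as polynomials in the entry moments -/

/-- The exponent of the entry `(i, j)` in the product of the monomials of the permutations `σ`. -/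
def entryExponent {n : ℕ} (σ : Fin 6 → Equiv.Perm (Fin n)) (i j : Fin n) : ℕ :=
  (Finset.univ.filter fun a => σ a j = i).card

lemma sum_entryExponent {n : ℕ} (σ : Fin 6 → Equiv.Perm (Fin n)) (j : Fin n) :
    ∑ i, entryExponent σ i j = 6 := by
  have := Finset.card_eq_sum_card_fiberwise (f := fun a => σ a j) (s := Finset.univ)
    (t := Finset.univ) (fun _ _ => Finset.mem_coe.mpr (Finset.mem_univ _))
  simpa [entryExponent] using this.symm

lemma entryExponent_le {n : ℕ} (σ : Fin 6 → Equiv.Perm (Fin n)) (i j : Fin n) :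
    entryExponent σ i j ≤ 6 :=
  (Finset.card_filter_le _ _).trans (by simp)

lemma det_pow_six_eq_sum {n : ℕ} (M : Matrix (Fin n) (Fin n) ℝ) :
    M.det ^ 6 = ∑ σ : Fin 6 → Equiv.Perm (Fin n),
      (∏ a, ((Equiv.Perm.sign (σ a) : ℤ) : ℝ)) * ∏ i, ∏ j, M i j ^ entryExponent σ i j := by
  rw [Matrix.det_apply', Fintype.sum_pow]
  refine Finset.sum_congr rfl fun σ _ => ?_
  rw [Finset.prod_mul_distrib]
  congr 1
  rw [Finset.prod_comm, Finset.prod_comm (f := fun i j => M i j ^ entryExponent σ i j)]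
  refine Finset.prod_congr rfl fun j _ => ?_
  rw [← Finset.prod_fiberwise Finset.univ (fun a => σ a j)]
  refine Finset.prod_congr rfl fun i _ => ?_
  rw [entryExponent, ← Finset.prod_const]
  exact Finset.prod_congr rfl fun a ha => by rw [(Finset.mem_filter.mp ha).2]

lemma weightedSum_prod {ι : Type*} [Fintype ι] (w : ι → ℝ) {n : ℕ} (F : Fin n → ι → ℝ) :
    weightedSum w (fun u => ∏ j, F j (u j)) = ∏ j, ∑ x, w x * F j x := by
  rw [Finset.prod_univ_sum, Fintype.piFinset_univ, weightedSum]
  simp only [Finset.prod_mul_distrib]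

lemma detSixth_eq_sum {ι : Type*} [Fintype ι] (w v : ι → ℝ) (n : ℕ) :
    detSixth w v n = ∑ σ : Fin 6 → Equiv.Perm (Fin n),
      (∏ a, ((Equiv.Perm.sign (σ a) : ℤ) : ℝ)) *
        ∏ i, ∏ j, ∑ x, w x * v x ^ entryExponent σ i j := by
  rw [detSixth]
  simp only [det_pow_six_eq_sum, weightedSum_sum, weightedSum_mul_left, Matrix.of_apply]
  refine Finset.sum_congr rfl fun σ _ => ?_
  congr 1
  rw [weightedSum_prod (prodWeight w n) fun i r => ∏ j, v (r j) ^ entryExponent σ i j]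
  simp only [sum_prodWeight_mul]
  exact Finset.prod_congr rfl fun i _ => weightedSum_prod w fun j x => v x ^ entryExponent σ i j

/-! ### Integrability and expansion of the determinant moment of `Ω`. -/

section Measure

variable (Ω : Measure ℝ) [IsProbabilityMeasure Ω]

lemma integrable_pow_of_le_six (hint : Integrable (fun x : ℝ => x ^ 6) Ω) {k : ℕ} (hk : k ≤ 6) :
    Integrable (fun x : ℝ => x ^ k) Ω := by
  refine ((integrable_const (1 : ℝ)).add hint).mono' (by fun_prop) (ae_of_all _ fun x => ?_)
  rw [Real.norm_eq_abs, abs_pow, Pi.add_apply, ← Even.pow_abs (by decide : Even 6) x]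
  rcases le_total |x| 1 with h | h
  · have := pow_le_one₀ (n := k) (abs_nonneg x) h
    have := pow_nonneg (abs_nonneg x) 6
    linarith
  · have := pow_le_pow_right₀ h hk
    linarith

lemma measurable_matrix_of (n : ℕ) :
    Measurable fun x : Fin n × Fin n → ℝ => (Matrix.of fun i j => x (i, j) :
      Matrix (Fin n) (Fin n) ℝ) :=
  measurable_pi_lambda _ fun i => measurable_pi_lambda _ fun j => measurable_pi_apply (i, j)

lemma measurable_det_pow_six (n : ℕ) :
    Measurable fun M : Matrix (Fin n) (Fin n) ℝ => M.det ^ 6 := by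
  have h : ∀ i j, Measurable fun M : Matrix (Fin n) (Fin n) ℝ => M i j := fun i j =>
    (measurable_pi_apply j).comp (measurable_pi_apply (X := fun _ : Fin n => Fin n → ℝ) i)
  simp only [Matrix.det_apply']
  fun_prop

lemma det_pow_six_of_eq_sum {n : ℕ} (x : Fin n × Fin n → ℝ) :
    (Matrix.of fun i j => x (i, j)).det ^ 6 = ∑ σ : Fin 6 → Equiv.Perm (Fin n),
      (∏ a, ((Equiv.Perm.sign (σ a) : ℤ) : ℝ)) * ∏ p, x p ^ entryExponent σ p.1 p.2 := by
  rw [det_pow_six_eq_sum]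
  simp only [Fintype.prod_prod_type, Matrix.of_apply]

variable {Ω}

lemma integrable_monomial (hint : Integrable (fun x : ℝ => x ^ 6) Ω) {n : ℕ}
    (σ : Fin 6 → Equiv.Perm (Fin n)) :
    Integrable (fun x : Fin n × Fin n → ℝ => (∏ a, ((Equiv.Perm.sign (σ a) : ℤ) : ℝ)) *
      ∏ p, x p ^ entryExponent σ p.1 p.2) (Measure.pi fun _ => Ω) :=
  (Integrable.fintype_prod (f := fun (p : Fin n × Fin n) (t : ℝ) => t ^ entryExponent σ p.1 p.2)
    fun p => integrable_pow_of_le_six Ω hint (entryExponent_le σ p.1 p.2)).const_mul _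

lemma integrable_det_pow_six (hint : Integrable (fun x : ℝ => x ^ 6) Ω) (n : ℕ) :
    Integrable (fun M : Matrix (Fin n) (Fin n) ℝ => M.det ^ 6) (matrixDist Ω n) := by
  rw [matrixDist, integrable_map_measure (measurable_det_pow_six n).aestronglyMeasurable
    (measurable_matrix_of n).aemeasurable]
  simp only [Function.comp_def, det_pow_six_of_eq_sum]
  exact integrable_finsetSum _ fun σ _ => integrable_monomial hint σ

lemma detMoment_six_eq_sum (hint : Integrable (fun x : ℝ => x ^ 6) Ω) (n : ℕ) :
    detMoment Ω 6 n = ∑ σ : Fin 6 → Equiv.Perm (Fin n),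
      (∏ a, ((Equiv.Perm.sign (σ a) : ℤ) : ℝ)) *
        ∏ i, ∏ j, entryMoment Ω (entryExponent σ i j) := by
  rw [detMoment, matrixDist, integral_map (measurable_matrix_of n).aemeasurable
    (measurable_det_pow_six n).aestronglyMeasurable]
  simp only [det_pow_six_of_eq_sum]
  rw [integral_finsetSum _ fun σ _ => integrable_monomial hint σ]
  refine Finset.sum_congr rfl fun σ _ => ?_
  rw [integral_const_mul]
  congr 1
  rw [integral_fintype_prod_eq_prod (f := fun (p : Fin n × Fin n) (t : ℝ) =>
    t ^ entryExponent σ p.1 p.2), Fintype.prod_prod_type]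
  rfl

end Measure

/-- If some exponent is `5`, the others add up to `1`, so one of them is `1` and both products
vanish. This is why the fifth moment is irrelevant. -/
lemma prod_eq_prod_of_sum_eq_six {n : ℕ} {m m' : ℕ → ℝ} (h1 : m 1 = 0)
    (hm : ∀ k ≤ 6, k ≠ 5 → m k = m' k) (c : Fin n → ℕ) (hc : ∑ i, c i = 6) :
    ∏ i, m (c i) = ∏ i, m' (c i) := by
  by_cases h5 : ∃ i, c i = 5
  · obtain ⟨i, hi⟩ := h5
    have hs : ∑ k ∈ Finset.univ.erase i, c k = 1 := by
      have := Finset.add_sum_erase Finset.univ c (Finset.mem_univ i)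
      omega
    obtain ⟨k, hk, hk0⟩ := Finset.exists_ne_zero_of_sum_ne_zero (hs.trans_ne one_ne_zero)
    have hk1 : c k = 1 := by
      have := Finset.single_le_sum (fun _ _ => Nat.zero_le _) hk (f := c)
      omega
    rw [Finset.prod_eq_zero (Finset.mem_univ k) (by rw [hk1, h1]),
      Finset.prod_eq_zero (Finset.mem_univ k) (by rw [hk1, ← hm 1 (by omega) (by omega), h1])]
  · push Not at h5
    refine Finset.prod_congr rfl fun i _ => hm _ ?_ (h5 i)
    rw [← hc]
    exact Finset.single_le_sum (fun _ _ => Nat.zero_le _) (Finset.mem_univ i)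

/-- The sixth moment of the determinant only depends on the cumulants of the entries. -/
lemma detMoment_six_eq_detSixth {Ω : Measure ℝ} [IsProbabilityMeasure Ω]
    (hint : Integrable (fun x : ℝ => x ^ 6) Ω)
    (h1 : entryMoment Ω 1 = 0) (h2 : entryMoment Ω 2 = 1) (h3 : entryMoment Ω 3 = 0)
    {ι : Type*} [Fintype ι] {w v : ι → ℝ} (h : HasCumulants w v (entryMoment Ω 4 - 3)
      (entryMoment Ω 6 - 15 * entryMoment Ω 4 + 30)) (n : ℕ) :
    detMoment Ω 6 n = detSixth w v n := by
  rw [detMoment_six_eq_sum hint, detSixth_eq_sum]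
  refine Finset.sum_congr rfl fun σ _ => ?_
  congr 1
  -- The product is regrouped by columns, where the exponents add up to six.
  rw [Finset.prod_comm, Finset.prod_comm (f := fun i j => ∑ x, w x * v x ^ entryExponent σ i j)]
  refine Finset.prod_congr rfl fun j _ => ?_
  refine prod_eq_prod_of_sum_eq_six (m' := fun k => ∑ x, w x * v x ^ k) h1 (fun k hk hk5 => ?_)
    (fun i => entryExponent σ i j) (sum_entryExponent σ j)
  have h0 : entryMoment Ω 0 = 1 := by simp [entryMoment]
  interval_cases k
  · simp [h0, h.zero]
  · simp [h1, h.one]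
  · rw [h2, h.two]
  · rw [h3, h.three]
  · rw [h.four]; ring
  · exact absurd rfl hk5
  · rw [h.six]; ring

/-! ### Matching the stated series with the partial sums. -/

section Final

open PowerSeries

variable (Ω : Measure ℝ)

lemma denomSeries_eq : denomSeries Ω = 1 - C (entryMoment Ω 4 - 3) * X := by
  rw [denomSeries, map_sub]
  ring

lemma inv_denomSeries_pow (k : ℕ) :
    (denomSeries Ω ^ k)⁻¹ = geomSeries (entryMoment Ω 4 - 3) ^ k := by
  symm
  rw [PowerSeries.eq_inv_iff_mul_eq_one (by simp [denomSeries]), denomSeries_eq, ← mul_pow,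
    geomSeries_mul, one_pow]

lemma inv_C_mul_denomSeries_pow :
    (C 48 * denomSeries Ω ^ 15)⁻¹ = C (1 / 48) * geomSeries (entryMoment Ω 4 - 3) ^ 15 := by
  rw [PowerSeries.mul_inv_rev, inv_denomSeries_pow, PowerSeries.C_inv, mul_comm, one_div]

lemma coeff_genFunTerm_of_lt {n i : ℕ} (hi : n < i) : coeff n (genFunTerm Ω i) = 0 := by
  rw [genFunTerm, mul_assoc, coeff_C_mul, coeff_X_pow_mul', if_neg (by omega), mul_zero]

lemma hasSum_coeff_genFunTerm {n N : ℕ} (hn : n < N) :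
    HasSum (fun i => coeff n (genFunTerm Ω i))
      (coeff n (∑ i ∈ Finset.range N, genFunTerm Ω i)) := by
  rw [map_sum]
  exact hasSum_sum_of_ne_finset_zero fun i hi =>
    coeff_genFunTerm_of_lt Ω (hn.trans_le (by simpa using hi))

lemma summable_genFunTerm : Summable (genFunTerm Ω) :=
  (WithPiTopology.summable_iff_summable_coeff ℝ).mpr fun n =>
    (hasSum_coeff_genFunTerm Ω n.lt_succ_self).summable

lemma coeff_tsum_genFunTerm {n N : ℕ} (hn : n < N) :
    coeff n (∑' i, genFunTerm Ω i) = coeff n (∑ i ∈ Finset.range N, genFunTerm Ω i) :=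
  (((WithPiTopology.hasSum_iff_hasSum_coeff ℝ).mp (summable_genFunTerm Ω).hasSum) n).unique
    (hasSum_coeff_genFunTerm Ω hn)

/-- The factor `X ^ i` keeps summands with `i > n` out of the coefficients up to `n`, so the
infinite sum can be truncated. -/
lemma coeff_mul_tsum_genFunTerm (P : PowerSeries ℝ) {n N : ℕ} (hn : n < N) :
    coeff n (P * ∑' i, genFunTerm Ω i) = coeff n (P * ∑ i ∈ Finset.range N, genFunTerm Ω i) := by
  rw [coeff_mul, coeff_mul]
  refine Finset.sum_congr rfl fun p hp => ?_
  have := Finset.HasAntidiagonal.mem_antidiagonal.mp hp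
  rw [coeff_tsum_genFunTerm Ω (by omega : p.2 < N)]

lemma prefactor_mul_sum_genFunTerm (κ₆ : ℝ) (N : ℕ) :
    formalExp κ₆ * (C 48 * denomSeries Ω ^ 15)⁻¹ * ∑ i ∈ Finset.range N, genFunTerm Ω i =
      sixthPartial N (entryMoment Ω 4 - 3) κ₆ := by
  rw [sixthPartial, Finset.mul_sum]
  refine Finset.sum_congr rfl fun i _ => ?_
  have hg : (C (gaussianCoeff i) : PowerSeries ℝ) =
      C (1 / 48) * C ((1 + (i : ℝ)) * (2 + (i : ℝ)) * ((4 + i).factorial : ℝ)) := by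
    rw [← map_mul, gaussianCoeff]
    congr 1
    ring
  rw [inv_C_mul_denomSeries_pow, genFunTerm, inv_denomSeries_pow, sixthTerm, hg]
  ring

end Final

/-- The infinite sum of formal power series is taken coefficientwise (product topology on
`PowerSeries ℝ`); that it converges, and that the expectations exist, is part of the claim. -/
theorem theorem1 (Ω : Measure ℝ) [IsProbabilityMeasure Ω]
    (hint : Integrable (fun x : ℝ => x ^ 6) Ω)
    (h1 : entryMoment Ω 1 = 0) (h2 : entryMoment Ω 2 = 1) (h3 : entryMoment Ω 3 = 0) :
    (∀ n : ℕ, Integrable (fun M : Matrix (Fin n) (Fin n) ℝ => M.det ^ 6) (matrixDist Ω n)) ∧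
    Summable (genFunTerm Ω) ∧
    detGenFun Ω 6 =
      formalExp (entryMoment Ω 6 - 15 * entryMoment Ω 4 + 30) *
        (PowerSeries.C 48 * denomSeries Ω ^ 15)⁻¹ * ∑' i : ℕ, genFunTerm Ω i := by
  refine ⟨integrable_det_pow_six hint, summable_genFunTerm Ω, ?_⟩
  ext n
  have hn := n.lt_succ_self
  -- The path is taken at its endpoint `s = 1`, with truncation `N = n + 1`.
  have h := (detSixth_eq_coeff (entryMoment Ω 4 - 3)
    (entryMoment Ω 6 - 15 * entryMoment Ω 4 + 30) n hn 1).1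
  simp only [one_mul] at h
  rw [coeff_mul_tsum_genFunTerm Ω _ hn, prefactor_mul_sum_genFunTerm, detGenFun,
    PowerSeries.coeff_mk, detMoment_six_eq_detSixth hint h1 h2 h3 (hasCumulants_lawWeight _ _), h]
  field_simp
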